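/- **Setting.** Let $\mathcal V$ be a monoidal model category whose unit object $I$ is cofibrant: $\mathcal V$ is a complete and cocomplete symmetric monoidal closed category, with internal hom $[-,-]$, equipped with a model structure such that for cofibrations $f,g$ the pushout-product $f\mathbin{\square} g$ is a cofibration, which is moreover a weak equivalence if $f$ or $g$ is one. (Since $I$ is cofibrant, the usual unit axiom holds automatically.) Assume that the category $\mathcal V$ is locally presentable. For a $\mathcal V$-category $\mathcal C$ write $\mathcal C_0$ for its underlying ordinary category; for a small $\mathcal V$-category $\mathcal D$ and $\mathcal V$-functors $F,G\colon\mathcal D\to\mathcal V$ write $[\mathcal D,\mathcal V](F,G)=\int_{X}[FX,GX]$ for the object of $\mathcal V$-natural transformations. **Shrinkable morphisms.** An *interval* is an object $J$ of $\mathcal V$ with a factorisation $I+I\xrightarrow{(d\ c)}J\xrightarrow{e}I$ of the codiagonal in which $(d\ c)$ is a cofibration and $e$ is a weak equivalence. A morphism $f\colon A\to B$ of $\mathcal V$ is *shrinkable* if there are a morphism $s\colon B\to A$ with $fs=1_B$, an interval $(J,d,c,e)$ and a morphism $h\colon J\to[A,A]$ such that $hd$ and $hc$ are the names $I\to [A,A]$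 of $sf$ and of $1_A$, and such that $[A,f]\circ h$ factorises through $e$. Let $\mathcal E$ be the class of shrinkable morphisms of $\mathcal V$. **$\mathcal E$-weak colimits.** $\mathcal C$ *admits all $\mathcal E$-weak colimits* if for every small $\mathcal V$-category $\mathcal D$ and all $\mathcal V$-functors $W\colon\mathcal D^{\mathrm{op}}\to\mathcal V$ and $S\colon\mathcal D\to\mathcal C$ there are an object $L$ of $\mathcal C$ and a $\mathcal V$-natural transformation $\eta\colon W\to\mathcal C(S-,L)$ such that for every object $A$ of $\mathcal C$ the induced morphism $\mathcal C(L,A)\to[\mathcal D^{\mathrm{op}},\mathcal V](W,\mathcal C(S-,A))$ lies in $\mathcal E$. **Powers and enough cofibrantly-weighted limits.** $\mathcal C$ has *powers* if for all $X\in\mathcal V$ and $B\in\mathcal C$ there are an object $P$ of $\mathcal C$ and a morphism $X\to\mathcal C(P,B)$ inducing isomorphisms $\mathcal C(A,P)\cong[X,\mathcal C(A,B)]$ for all $A$. For a small $\mathcal D$, a weight $Q\colon\mathcal D\to\mathcal V$ is *cofibrant* if $[\mathcal D,\mathcal V](Q,p)$ is a trivial fibration in $\mathcal V$ whenever $p$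 is a pointwise trivial fibration between $\mathcal V$-functors $\mathcal D\to\mathcal V$. Let $\mathcal I$ be the unit $\mathcal V$-category (one object, with endomorphism object $I$) and let $I\colon\mathcal I\to\mathcal V$ also denote the $\mathcal V$-functor selecting the object $I$. $\mathcal C$ has *enough cofibrantly-weighted limits* if for every small $\mathcal V$-category $\mathcal D$ and every $\mathcal V$-functor $P\colon\mathcal D\to\mathcal I$ there are a cofibrant weight $Q\colon\mathcal D\to\mathcal V$ and a pointwise trivial fibration $Q\to IP$ such that $\mathcal C$ has the $Q$-weighted limit of every $\mathcal V$-functor $\mathcal D\to\mathcal C$. **Accessibility.** A *conical colimit* in $\mathcal C$ is a colimit in $\mathcal C_0$ that each $\mathcal C(-,X)_0\colon\mathcal C_0^{\mathrm{op}}\to\mathcal V$ sends to a limit. For a regular cardinal $\lambda$, an object $A$ of $\mathcal C$ is *$\lambda$-presentable* if $\mathcal C(A,-)$ preserves conical $\lambda$-filtered colimits, and $\mathcal C$ is *$\lambda$-accessible* if it has all small conical $\lambda$-filtered colimits and there is a (small) set $\mathcal G$ of $\lambda$-presentable objects such that every object of $\mathcal C$ is a conical $\lambda$-filtered colimit of objects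 of $\mathcal G$. $\mathcal C$ is *accessible* if it is $\lambda$-accessible for some regular cardinal $\lambda$ for which there is a regular $\lambda_0\le\lambda$ such that $\mathcal V$ is locally $\lambda_0$-presentable, $I$ is $\lambda_0$-presentable, and the $\lambda_0$-presentable objects of $\mathcal V$ are closed under $\otimes$. **Theorem.** Let $\mathcal C$ be an accessible $\mathcal V$-category with powers and enough cofibrantly-weighted limits. Then $\mathcal C$ admits all $\mathcal E$-weak colimits. -/

import Mathlib

open CategoryTheory MonoidalCategory Limits HomotopicalAlgebra Opposite
open scoped CategoryTheory.MonoidalClosed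

universe v u w u'

namespace EWeak
noncomputable section

variable {V : Type u} [Category.{v} V] [MonoidalCategory V] [SymmetricCategory V] [MonoidalClosed V]

section Weights
variable {D : Type w} [EnrichedCategory V D]

/-- A `V`-natural transformation `F ⟶ G` between `V`-functors `F G : D → V`: a family
`p_X : F X ⟶ G X` such that the two maps `D(X,Y) ⟶ [F X, G Y]`, namely `F_{XY}` followed by
`[F X, p_Y]` and `G_{XY}` followed by `[p_X, G Y]`, agree. -/
structure WeightHom (F G : EnrichedFunctor V D V) where
  app (X : D) : F.obj X ⟶ G.obj X
  naturality (X Y : D) :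
    F.map X Y ≫ (ihom (F.obj X)).map (app Y) =
      G.map X Y ≫ (MonoidalClosed.pre (app X)).app (G.obj Y)

/-- The transpose `F X ⊗ D(X,Y) ⟶ F Y` of the action of a `V`-functor `F : D → V` on homs. -/
def act (F : EnrichedFunctor V D V) (X Y : D) : F.obj X ⊗ EnrichedCategory.Hom X Y ⟶ F.obj Y :=
  MonoidalClosed.uncurry (F.map X Y)

lemma WeightHom.act_comp {F G : EnrichedFunctor V D V} (p : WeightHom F G) (X Y : D) :
    act F X Y ≫ p.app Y = p.app X ▷ _ ≫ act G X Y := by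
  have h := congrArg MonoidalClosed.uncurry (p.naturality X Y)
  rw [MonoidalClosed.uncurry_pre_app] at h
  exact (MonoidalClosed.uncurry_natural_right _ _).symm.trans h

/-- The map `[F X, G X] ⟶ [D(X,Y), [F X, G Y]]` given by the action of `G` on homs. -/
def wedgeLeft (F G : EnrichedFunctor V D V) (X Y : D) :
    (ihom (F.obj X)).obj (G.obj X) ⟶
      (ihom (EnrichedCategory.Hom X Y : V)).obj ((ihom (F.obj X)).obj (G.obj Y)) :=
  MonoidalClosed.curry ((β_ _ _).hom ≫ _ ◁ G.map X Y ≫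
    eComp V (F.obj X) (G.obj X) (G.obj Y))

/-- The map `[F Y, G Y] ⟶ [D(X,Y), [F X, G Y]]` given by the action of `F` on homs. -/
def wedgeRight (F G : EnrichedFunctor V D V) (X Y : D) :
    (ihom (F.obj Y)).obj (G.obj Y) ⟶
      (ihom (EnrichedCategory.Hom X Y : V)).obj ((ihom (F.obj X)).obj (G.obj Y)) :=
  MonoidalClosed.curry (F.map X Y ▷ _ ≫ eComp V (F.obj X) (F.obj Y) (G.obj Y))

lemma uncurry_eComp {A B C X Y : V} (f : X ⟶ (ihom A).obj B) (g : Y ⟶ (ihom B).obj C) :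
    MonoidalClosed.uncurry ((f ⊗ₘ g) ≫ eComp V A B C) =
      (α_ _ _ _).inv ≫ MonoidalClosed.uncurry f ▷ Y ≫ MonoidalClosed.uncurry g := by
  change MonoidalClosed.uncurry ((f ⊗ₘ g) ≫ MonoidalClosed.comp A B C) = _
  rw [MonoidalClosed.uncurry_natural_left, MonoidalClosed.comp_eq, MonoidalClosed.uncurry_curry,
    MonoidalClosed.compTranspose_eq]
  simp only [MonoidalClosed.uncurry_eq, MonoidalCategory.tensorHom_def,
    MonoidalCategory.whiskerLeft_comp, comp_whiskerRight, Category.assoc]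
  rw [associator_inv_naturality_right_assoc, whisker_exchange_assoc,
    associator_inv_naturality_middle_assoc]
  rfl

lemma wedge_iff (F G : EnrichedFunctor V D V) {A : V}
    (k : ∀ X, A ⟶ (ihom (F.obj X)).obj (G.obj X)) (X Y : D) :
    k X ≫ wedgeLeft F G X Y = k Y ≫ wedgeRight F G X Y ↔
      _ ◁ (β_ _ _).hom ≫ (α_ _ _ _).inv ≫ MonoidalClosed.uncurry (k X) ▷ _ ≫ act G X Y =
        (α_ _ _ _).inv ≫ act F X Y ▷ A ≫ MonoidalClosed.uncurry (k Y) := by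
  rw [wedgeLeft, wedgeRight, ← MonoidalClosed.curry_natural_left,
    ← MonoidalClosed.curry_natural_left, MonoidalClosed.curry_injective.eq_iff,
    ← MonoidalClosed.uncurry_injective.eq_iff]
  have e1 : (EnrichedCategory.Hom X Y : V) ◁ k X ≫ (β_ _ _).hom ≫ _ ◁ G.map X Y ≫
      eComp V (F.obj X) (G.obj X) (G.obj Y) =
      (β_ _ _).hom ≫ (k X ⊗ₘ G.map X Y) ≫ eComp V (F.obj X) (G.obj X) (G.obj Y) := by
    rw [BraidedCategory.braiding_naturality_right_assoc, MonoidalCategory.tensorHom_def, Category.assoc]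
  have e2 : (EnrichedCategory.Hom X Y : V) ◁ k Y ≫ F.map X Y ▷ _ ≫
      eComp V (F.obj X) (F.obj Y) (G.obj Y) =
      (F.map X Y ⊗ₘ k Y) ≫ eComp V (F.obj X) (F.obj Y) (G.obj Y) := by
    rw [MonoidalCategory.tensorHom_def', Category.assoc]
  rw [e1, e2, MonoidalClosed.uncurry_natural_left]
  erw [uncurry_eComp, uncurry_eComp]
  rfl

end Weights

section NatObj
variable [HasLimits V] {D : Type v} [EnrichedCategory V D]

/-- The object `[D,V](F,G)` of `V`-natural transformations, for a small `V`-category `D`: the end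
`∫_X [F X, G X]`, built as the equalizer of the two maps
`∏_X [F X, G X] ⇉ ∏_{X,Y} [D(X,Y), [F X, G Y]]`. -/
def natObj (F G : EnrichedFunctor V D V) : V :=
  equalizer
    (Pi.lift fun p : D × D =>
      Pi.π (fun X : D => (ihom (F.obj X)).obj (G.obj X)) p.1 ≫ wedgeLeft F G p.1 p.2)
    (Pi.lift fun p : D × D =>
      Pi.π (fun X : D => (ihom (F.obj X)).obj (G.obj X)) p.2 ≫ wedgeRight F G p.1 p.2)

/-- The projection `[D,V](F,G) ⟶ [F X, G X]`. -/
def natObjπ (F G : EnrichedFunctor V D V) (X : D) :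
    natObj F G ⟶ (ihom (F.obj X)).obj (G.obj X) :=
  equalizer.ι _ _ ≫ Pi.π _ X

lemma natObjπ_wedge (F G : EnrichedFunctor V D V) (X Y : D) :
    natObjπ F G X ≫ wedgeLeft F G X Y = natObjπ F G Y ≫ wedgeRight F G X Y := by
  have h := equalizer.condition
    (Pi.lift fun p : D × D =>
      Pi.π (fun X : D => (ihom (F.obj X)).obj (G.obj X)) p.1 ≫ wedgeLeft F G p.1 p.2)
    (Pi.lift fun p : D × D =>
      Pi.π (fun X : D => (ihom (F.obj X)).obj (G.obj X)) p.2 ≫ wedgeRight F G p.1 p.2)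
  have h' := congrArg (fun t => t ≫ Pi.π _ (X, Y)) h
  simp only [Category.assoc, Pi.lift_π] at h'
  exact (Category.assoc _ _ _).trans (h'.trans (Category.assoc _ _ _).symm)

/-- The universal property of `[D,V](F,G)` as an end. -/
def natObjLift (F G : EnrichedFunctor V D V) {A : V}
    (k : ∀ X, A ⟶ (ihom (F.obj X)).obj (G.obj X))
    (hk : ∀ X Y, k X ≫ wedgeLeft F G X Y = k Y ≫ wedgeRight F G X Y) : A ⟶ natObj F G :=
  equalizer.lift (Pi.lift k) (by
    apply Pi.hom_ext
    rintro ⟨X, Y⟩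
    simpa using hk X Y)

@[simp]
lemma natObjLift_π (F G : EnrichedFunctor V D V) {A : V}
    (k : ∀ X, A ⟶ (ihom (F.obj X)).obj (G.obj X))
    (hk : ∀ X Y, k X ≫ wedgeLeft F G X Y = k Y ≫ wedgeRight F G X Y) (X : D) :
    natObjLift F G k hk ≫ natObjπ F G X = k X :=
  (equalizer.lift_ι_assoc _ _ _).trans (Pi.lift_π _ _)

/-- The map `[D,V](Q,p) : [D,V](Q,F) ⟶ [D,V](Q,G)` given by composition with `p : F ⟶ G`. -/
def natObjMap (Q : EnrichedFunctor V D V) {F G : EnrichedFunctor V D V} (p : WeightHom F G) :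
    natObj Q F ⟶ natObj Q G :=
  natObjLift Q G (fun X => natObjπ Q F X ≫ (ihom (Q.obj X)).map (p.app X)) (fun X Y => by
    have h := (wedge_iff Q F (natObjπ Q F) X Y).1 (natObjπ_wedge Q F X Y)
    refine (wedge_iff Q G (fun X => natObjπ Q F X ≫ (ihom (Q.obj X)).map (p.app X)) X Y).2 ?_
    rw [MonoidalClosed.uncurry_natural_right, MonoidalClosed.uncurry_natural_right,
      comp_whiskerRight_assoc, ← p.act_comp]
    have h' := congrArg (fun t => t ≫ p.app Y) h
    simpa using h')

end NatObj

section Representables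
variable {C : Type u'} [EnrichedCategory V C]

/-- The representable `V`-functor `C(B,-) : C → V`. -/
def coyo (B : C) : EnrichedFunctor V C V where
  obj X := EnrichedCategory.Hom B X
  map X Y := MonoidalClosed.curry (eComp V B X Y)
  map_id X := by
    rw [← MonoidalClosed.curry_natural_left]
    change _ = MonoidalClosed.id _
    rw [MonoidalClosed.id_eq]
    congr 1
    rw [← cancel_epi (ρ_ _).inv, e_comp_id, Iso.inv_hom_id]
  map_comp X Y Z := by
    apply MonoidalClosed.uncurry_injective
    erw [uncurry_eComp]
    rw [MonoidalClosed.uncurry_natural_left, MonoidalClosed.uncurry_curry,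
      MonoidalClosed.uncurry_curry, MonoidalClosed.uncurry_curry, e_assoc]

lemma act_coyo (B X Y : C) : act (coyo (V := V) B) X Y = eComp V B X Y :=
  MonoidalClosed.uncurry_curry _

/-- The representable `V`-functor `C(-,A) : Cᵒᵖ → V`. -/
def yo (A : C) : EnrichedFunctor V Cᵒᵖ V where
  obj X := EnrichedCategory.Hom X.unop A
  map X Y := MonoidalClosed.curry ((β_ _ _).hom ≫ eComp V Y.unop X.unop A)
  map_id X := (coyo (V := V) (op A)).map_id X
  map_comp X Y Z := (coyo (V := V) (op A)).map_comp X Y Z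

lemma act_yo (A : C) (X Y : Cᵒᵖ) :
    act (yo (V := V) A) X Y = (β_ _ _).hom ≫ eComp V Y.unop X.unop A :=
  MonoidalClosed.uncurry_curry _

/-- The opposite `Sᵒᵖ : Dᵒᵖ → Cᵒᵖ` of a `V`-functor `S`. -/
def opFunctor {D : Type w} [EnrichedCategory V D] (S : EnrichedFunctor V D C) :
    EnrichedFunctor V Dᵒᵖ Cᵒᵖ where
  obj X := op (S.obj X.unop)
  map X Y := S.map Y.unop X.unop
  map_id X := S.map_id X.unop
  map_comp X Y Z := by
    change ((β_ _ _).hom ≫ eComp V Z.unop Y.unop X.unop) ≫ S.map Z.unop X.unop =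
      (S.map Y.unop X.unop ⊗ₘ S.map Z.unop Y.unop) ≫ (β_ _ _).hom ≫
        eComp V (S.obj Z.unop) (S.obj Y.unop) (S.obj X.unop)
    rw [Category.assoc, S.map_comp, BraidedCategory.braiding_naturality_assoc]

lemma act_comp_functor {D : Type w} [EnrichedCategory V D] (S : EnrichedFunctor V D C)
    (F : EnrichedFunctor V C V) (X Y : D) :
    act (S.comp V F) X Y = _ ◁ S.map X Y ≫ act F (S.obj X) (S.obj Y) :=
  MonoidalClosed.uncurry_natural_left _ _

/-- The `V`-functor `C(B,S-) : D → V`. -/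
abbrev homFrom {D : Type w} [EnrichedCategory V D] (S : EnrichedFunctor V D C) (B : C) :
    EnrichedFunctor V D V :=
  S.comp V (coyo B)

/-- The `V`-functor `C(S-,A) : Dᵒᵖ → V`. -/
abbrev homTo {D : Type w} [EnrichedCategory V D] (S : EnrichedFunctor V D C) (A : C) :
    EnrichedFunctor V Dᵒᵖ V :=
  (opFunctor S).comp V (yo A)

/-- The map `C(A,P) ⟶ [X, C(A,B)]` induced by `κ : X ⟶ C(P,B)`. -/
def powerMap {X : V} {P B : C} (κ : X ⟶ EnrichedCategory.Hom P B) (A : C) :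
    (EnrichedCategory.Hom A P : V) ⟶ (ihom X).obj (EnrichedCategory.Hom A B) :=
  MonoidalClosed.curry (κ ▷ _ ≫ (β_ _ _).hom ≫ eComp V A P B)

lemma limit_aux {P E P' : V} {B L X Y : C} (a : P ⟶ EnrichedCategory.Hom L X)
    (s : E ⟶ EnrichedCategory.Hom X Y) (b : P' ⟶ EnrichedCategory.Hom L Y) (r : P ⊗ E ⟶ P')
    (h : r ≫ b = a ▷ E ≫ _ ◁ s ≫ eComp V L X Y) :
    P ◁ (β_ E (EnrichedCategory.Hom B L)).hom ≫ (α_ _ _ _).inv ≫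
      (a ▷ _ ≫ (β_ _ _).hom ≫ eComp V B L X) ▷ E ≫ _ ◁ s ≫ eComp V B X Y =
    (α_ _ _ _).inv ≫ r ▷ _ ≫ b ▷ _ ≫ (β_ _ _).hom ≫ eComp V B L Y := by
  rw [← comp_whiskerRight_assoc, h]
  simp only [comp_whiskerRight, Category.assoc]
  rw [BraidedCategory.braiding_naturality_left_assoc, ← e_assoc, ← whisker_exchange_assoc,
    ← whisker_exchange_assoc, BraidedCategory.braiding_naturality_left_assoc,
    BraidedCategory.braiding_naturality_left_assoc, associator_inv_naturality_right_assoc,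
    associator_inv_naturality_middle_assoc, ← whisker_exchange_assoc,
    ← comp_whiskerRight_assoc _ (β_ _ _).hom, BraidedCategory.braiding_naturality_left,
    comp_whiskerRight_assoc, BraidedCategory.hexagon_reverse_assoc, whisker_exchange_assoc,
    whisker_exchange_assoc]

lemma colimit_aux {P E P' : V} {A L X Y : C} (a : P ⟶ EnrichedCategory.Hom X L)
    (s : E ⟶ EnrichedCategory.Hom Y X) (b : P' ⟶ EnrichedCategory.Hom Y L) (r : P ⊗ E ⟶ P')
    (h : r ≫ b = a ▷ E ≫ _ ◁ s ≫ (β_ _ _).hom ≫ eComp V Y X L) :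
    P ◁ (β_ E (EnrichedCategory.Hom L A)).hom ≫ (α_ _ _ _).inv ≫
      (a ▷ _ ≫ eComp V X L A) ▷ E ≫ _ ◁ s ≫ (β_ _ _).hom ≫ eComp V Y X A =
    (α_ _ _ _).inv ≫ r ▷ _ ≫ b ▷ _ ≫ eComp V Y L A := by
  have e : a ▷ E ≫ _ ◁ s ≫ (β_ _ _).hom = (β_ _ _).hom ≫ s ▷ P ≫ _ ◁ a := by
    rw [BraidedCategory.braiding_naturality_right, BraidedCategory.braiding_naturality_left_assoc,
      whisker_exchange]
  rw [← comp_whiskerRight_assoc, h, reassoc_of% e]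
  simp only [comp_whiskerRight, Category.assoc]
  rw [← whisker_exchange_assoc, ← whisker_exchange_assoc,
    BraidedCategory.braiding_naturality_left_assoc, BraidedCategory.braiding_naturality_left_assoc,
    BraidedCategory.braiding_naturality_right_assoc, ← e_assoc,
    associator_inv_naturality_middle_assoc, associator_inv_naturality_left_assoc,
    BraidedCategory.hexagon_reverse_assoc, ← MonoidalCategory.whiskerLeft_comp_assoc,
    SymmetricCategory.symmetry, MonoidalCategory.whiskerLeft_id, Category.id_comp]

variable [HasLimits V] {D : Type v} [EnrichedCategory V D]

/-- The map `C(B,L) ⟶ [D,V](Q, C(B,S-))` induced by a `V`-natural `η : Q ⟶ C(L,S-)`. -/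
def limitMap {Q : EnrichedFunctor V D V} {S : EnrichedFunctor V D C} {L : C}
    (η : WeightHom Q (homFrom S L)) (B : C) :
    (EnrichedCategory.Hom B L : V) ⟶ natObj Q (homFrom S B) :=
  natObjLift Q (homFrom S B)
    (fun X => MonoidalClosed.curry (η.app X ▷ _ ≫ (β_ _ _).hom ≫ eComp V B L (S.obj X)))
    (fun X Y => by
      refine (wedge_iff Q (homFrom S B) (fun X => MonoidalClosed.curry
        (η.app X ▷ _ ≫ (β_ _ _).hom ≫ eComp V B L (S.obj X))) X Y).2 ?_
      have h := η.act_comp X Y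
      rw [act_comp_functor, act_coyo] at h
      rw [act_comp_functor, act_coyo, MonoidalClosed.uncurry_curry, MonoidalClosed.uncurry_curry]
      exact limit_aux (η.app X) (S.map X Y) (η.app Y) (act Q X Y) h)

/-- The map `C(L,A) ⟶ [Dᵒᵖ,V](W, C(S-,A))` induced by a `V`-natural `η : W ⟶ C(S-,L)`. -/
def colimitMap {W : EnrichedFunctor V Dᵒᵖ V} {S : EnrichedFunctor V D C} {L : C}
    (η : WeightHom W (homTo S L)) (A : C) :
    (EnrichedCategory.Hom L A : V) ⟶ natObj W (homTo S A) :=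
  natObjLift W (homTo S A)
    (fun X => MonoidalClosed.curry (η.app X ▷ _ ≫ eComp V (S.obj X.unop) L A))
    (fun X Y => by
      refine (wedge_iff W (homTo S A) (fun X => MonoidalClosed.curry
        (η.app X ▷ _ ≫ eComp V (S.obj X.unop) L A)) X Y).2 ?_
      have h := η.act_comp X Y
      rw [act_comp_functor, act_yo] at h
      rw [act_comp_functor, act_yo, MonoidalClosed.uncurry_curry, MonoidalClosed.uncurry_curry]
      exact colimit_aux (η.app X) (S.map Y.unop X.unop) (η.app Y) (act W X Y) h)

end Representables

section UnitCat
variable (V)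

/-- The type of objects of the unit `V`-category: one object, with hom-object the unit `𝟙_ V`. -/
def UnitCat (_ : Type u) : Type := Unit

instance : EnrichedCategory V (UnitCat V) where
  Hom _ _ := 𝟙_ V
  id _ := 𝟙 _
  comp _ _ _ := (λ_ _).hom
  id_comp _ _ := by simp
  comp_id _ _ := by simp [unitors_equal]
  assoc _ _ _ _ := by monoidal

/-- The `V`-functor from the unit `V`-category to `V` selecting the unit object. -/
def unitWeight : EnrichedFunctor V (UnitCat V) V where
  obj _ := 𝟙_ V
  map _ _ := eId V (𝟙_ V)
  map_id _ := Category.id_comp _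
  map_comp _ _ _ := by
    change (λ_ (𝟙_ V)).hom ≫ eId V (𝟙_ V) = _
    have h := e_id_comp V (𝟙_ V) (𝟙_ V)
    have e : (eId V (𝟙_ V) ⊗ₘ eId V (𝟙_ V)) ≫ eComp V (𝟙_ V) (𝟙_ V) (𝟙_ V) =
        (λ_ (𝟙_ V)).hom ≫ eId V (𝟙_ V) := by
      rw [MonoidalCategory.tensorHom_def', Category.assoc, ← cancel_epi (λ_ (𝟙_ V)).inv,
        Iso.inv_hom_id_assoc, ← leftUnitor_inv_naturality_assoc, h, Category.comp_id]
    exact e.symm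

end UnitCat
section Limits
variable (V) (C : Type u') [EnrichedCategory V C]

/-- `C` has powers: for `X : V` and `B : C` there are `P` and `X ⟶ C(P,B)` inducing isomorphisms
`C(A,P) ≅ [X, C(A,B)]` for all `A`. -/
def HasPowers : Prop :=
  ∀ (X : V) (B : C), ∃ (P : C) (κ : X ⟶ EnrichedCategory.Hom P B),
    ∀ A : C, IsIso (powerMap κ A)

variable {V C}

/-- The limit of `S` weighted by `Q` exists. -/
def HasWeightedLimit [HasLimits V] {D : Type v} [EnrichedCategory V D]
    (Q : EnrichedFunctor V D V) (S : EnrichedFunctor V D C) : Prop :=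
  ∃ (L : C) (η : WeightHom Q (homFrom S L)), ∀ B : C, IsIso (limitMap η B)

end Limits

section Model
variable (V)

/-- The pushout-product axiom, together with cofibrancy of the unit (which makes the unit axiom
of a monoidal model category automatic). -/
structure IsMonoidalModel [ModelCategory V] : Prop where
  cofibration_pushoutProduct {A B X Y : V} (f : A ⟶ B) (g : X ⟶ Y) :
    Cofibration f → Cofibration g →
      Cofibration ((Arrow.pushoutProduct.obj (Arrow.mk f)).obj (Arrow.mk g)).hom
  weakEquivalence_pushoutProduct {A B X Y : V} (f : A ⟶ B) (g : X ⟶ Y) :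
    Cofibration f → Cofibration g → (WeakEquivalence f ∨ WeakEquivalence g) →
      WeakEquivalence ((Arrow.pushoutProduct.obj (Arrow.mk f)).obj (Arrow.mk g)).hom
  isCofibrant_unit : IsCofibrant (𝟙_ V)

/-- An interval: a factorisation of the codiagonal of the unit as a cofibration `(d c)`
followed by a weak equivalence `e`. -/
structure Interval [ModelCategory V] where
  J : V
  d : 𝟙_ V ⟶ J
  c : 𝟙_ V ⟶ J
  e : J ⟶ 𝟙_ V
  d_e : d ≫ e = 𝟙 _
  c_e : c ≫ e = 𝟙 _
  cofibration : Cofibration (coprod.desc d c)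
  weakEquivalence : WeakEquivalence e

variable {V}

/-- A morphism `f : A ⟶ B` of `V` is shrinkable if it has a section `s` and there is a homotopy
`h : J ⟶ [A,A]` from `f ≫ s` to the identity, along some interval `J`, whose composite with
`[A,f]` is trivial, that is, factorises through `e : J ⟶ I`. -/
def Shrinkable [ModelCategory V] {A B : V} (f : A ⟶ B) : Prop :=
  ∃ (s : B ⟶ A) (j : Interval V) (h : j.J ⟶ (ihom A).obj A),
    s ≫ f = 𝟙 B ∧
    j.d ≫ h = MonoidalClosed.curry' (f ≫ s) ∧
    j.c ≫ h = MonoidalClosed.curry' (𝟙 A) ∧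
    ∃ k : 𝟙_ V ⟶ (ihom A).obj B, h ≫ (ihom A).map f = j.e ≫ k

/-- `p` is a pointwise trivial fibration. -/
def IsPointwiseTrivialFibration [ModelCategory V] {D : Type w} [EnrichedCategory V D]
    {F G : EnrichedFunctor V D V} (p : WeightHom F G) : Prop :=
  ∀ X : D, trivialFibrations V (p.app X)

variable [HasLimits V]

/-- A weight `Q : D → V` is cofibrant if `[D,V](Q,p)` is a trivial fibration for every pointwise
trivial fibration `p`. -/
def IsCofibrantWeight [ModelCategory V] {D : Type v} [EnrichedCategory V D]
    (Q : EnrichedFunctor V D V) : Prop :=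
  ∀ (F G : EnrichedFunctor V D V) (p : WeightHom F G), IsPointwiseTrivialFibration p →
    trivialFibrations V (natObjMap Q p)

variable (V) (C : Type u') [EnrichedCategory V C]

/-- `C` has enough cofibrantly-weighted limits: for every small `V`-category `D` and every
`V`-functor `P` from `D` to the unit `V`-category there are a cofibrant weight `Q` and a pointwise
trivial fibration from `Q` to the composite of `P` with the functor selecting the unit, such that
`C` has all `Q`-weighted limits. -/
def HasEnoughCofibrantlyWeightedLimits [ModelCategory V] : Prop :=
  ∀ (D : Type v) [EnrichedCategory V D] (P : EnrichedFunctor V D (UnitCat V)),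
    ∃ (Q : EnrichedFunctor V D V) (p : WeightHom Q (P.comp V (unitWeight V))),
      IsCofibrantWeight Q ∧ IsPointwiseTrivialFibration p ∧
        ∀ S : EnrichedFunctor V D C, HasWeightedLimit Q S

/-- `C` has `E`-weak colimits, `E` the class of shrinkable morphisms of `V`: for all small `D`,
weights `W : Dᵒᵖ → V` and `S : D → C` there are `L` and a `V`-natural `W ⟶ C(S-,L)` such that the
induced `C(L,A) ⟶ [Dᵒᵖ,V](W, C(S-,A))` is shrinkable for every `A`. -/
def HasShrinkableWeakColimits [ModelCategory V] : Prop :=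
  ∀ (D : Type v) [EnrichedCategory V D] (W : EnrichedFunctor V Dᵒᵖ V) (S : EnrichedFunctor V D C),
    ∃ (L : C) (η : WeightHom W (homTo S L)), ∀ A : C, Shrinkable (colimitMap η A)

end Model

section Accessible

/-- A cocone in the underlying category of `C` is a conical colimit if it is a colimit there and
each `C(-,X)` sends it to a limit in `V`. -/
def IsConicalColimit {C : Type u'} [EnrichedCategory V C] {H : Type v} [SmallCategory H]
    {F : H ⥤ ForgetEnrichment V C} (c : Cocone F) : Prop :=
  Nonempty (IsColimit c) ∧
    ∀ X : ForgetEnrichment V C,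
      Nonempty (IsLimit (((eHomFunctor V (ForgetEnrichment V C)).flip.obj X).mapCone c.op))

variable (V)

/-- `A` is `κ`-presentable in the enriched sense: `C(A,-)` preserves conical `κ`-filtered
colimits. -/
def IsEnrichedPresentable {C : Type u'} [EnrichedCategory V C] (κ : Cardinal.{v})
    [Fact κ.IsRegular] (A : ForgetEnrichment V C) : Prop :=
  ∀ (H : Type v) [SmallCategory H] [IsCardinalFiltered H κ] (F : H ⥤ ForgetEnrichment V C)
    (c : Cocone F), IsConicalColimit c →
      Nonempty (IsColimit ((eCoyoneda V A).mapCocone c))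

/-- `C` is `κ`-accessible as a `V`-category: it has conical `κ`-filtered colimits, and a set of
`κ`-presentable objects of which every object is a conical `κ`-filtered colimit. -/
structure IsEnrichedCardinalAccessible (C : Type u') [EnrichedCategory V C] (κ : Cardinal.{v})
    [Fact κ.IsRegular] : Prop where
  exists_colimit (H : Type v) [SmallCategory H] [IsCardinalFiltered H κ]
    (F : H ⥤ ForgetEnrichment V C) : ∃ c : Cocone F, IsConicalColimit c
  exists_generator : ∃ (ι : Type v) (G : ι → ForgetEnrichment V C),
    (∀ i, IsEnrichedPresentable V κ (G i)) ∧
      ∀ X : ForgetEnrichment V C, ∃ (H : Type v) (_ : SmallCategory H) (_ : IsCardinalFiltered H κ)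
        (F : H ⥤ ForgetEnrichment V C) (t : F ⟶ (Functor.const H).obj X),
        (∀ h, ∃ i, Nonempty (F.obj h ≅ G i)) ∧ IsConicalColimit ⟨X, t⟩

/-- `V` is locally `κ₀`-presentable as a monoidal category: the unit is `κ₀`-presentable and
`κ₀`-presentable objects are closed under the tensor product. -/
structure IsMonoidalLocallyPresentable (κ₀ : Cardinal.{v}) [Fact κ₀.IsRegular] : Prop where
  isCardinalLocallyPresentable : IsCardinalLocallyPresentable V κ₀
  unit : IsCardinalPresentable (𝟙_ V) κ₀
  tensor (X Y : V) : IsCardinalPresentable X κ₀ → IsCardinalPresentable Y κ₀ →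
    IsCardinalPresentable (X ⊗ Y) κ₀

/-- `C` is an accessible `V`-category: `κ`-accessible for some regular `κ ≥ κ₀`, where `V` is
locally `κ₀`-presentable as a monoidal category. -/
def IsEnrichedAccessible (C : Type u') [EnrichedCategory V C] : Prop :=
  ∃ (κ₀ κ : Cardinal.{v}) (_ : Fact κ₀.IsRegular) (_ : Fact κ.IsRegular),
    IsMonoidalLocallyPresentable V κ₀ ∧ κ₀ ≤ κ ∧ IsEnrichedCardinalAccessible V C κ

end Accessible

end
end EWeak

/-!
The argument is a homotopical version of the adjoint functor theorem. An `E`-weak colimit of `S`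
weighted by `W` is an element `ξ : I ⟶ F L` of `F = [Dᵒᵖ,V](W, C(S-,-))` such that each evaluation
map `C(L,A) ⟶ F A` at `ξ` is shrinkable.

Suppose that `F` has a small weakly initial family of elements, and let `Q ⟶ I` be a cofibrant
weight that is pointwise trivially fibrant over the constant weight on the full sub-`V`-category of
the `V`-category of elements on this family. The `Q`-weighted limit `L` of the projection to `C`
carries an element `ξ` because `F` preserves weighted limits. It is homotopy initial: since `Q` is
cofibrant, `[Q,Q] ⟶ [Q,I]` is a trivial fibration, so that an endomorphism of `L` passing through a
member of the family is homotopic to the identity over `F L`; and any two maps from `ξ` to the same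
element are equalized up to homotopy by a limit of the same kind. These are statements about points
`I ⟶ C(L,B)`. Applied to powers `B` of `A` they become statements about morphisms with codomain
`C(L,A)`, namely a section of `C(L,A) ⟶ F A` and a shrinking homotopy for it.

For the solution set, let `A` be the colimit of a `κ`-directed diagram of `κ`-presentable objects.
A small amount of data factors a given cocone `W ⟶ C(S-,A)` through single stages of the diagram.
Close the set of these stages under upper bounds and under passage to an index equalizing a given
pair of morphisms. The colimit `B` over the resulting subdiagram maps to `A` by a morphism that is
monic on homs out of the generators, hence the cocone factors through `B` naturally. The subdiagram
is indexed by formal terms for the closure operations, so only a small set of them is needed.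
-/

namespace EWeak
noncomputable section

variable {V : Type u} [Category.{v} V] [MonoidalCategory V]

section Calculus

variable {C : Type u'} [EnrichedCategory V C]

/-- The composite of generalized elements `f` of `C(A,B)` and `g` of `C(B,D)`, in diagrammatic
order. -/
def hcomp {X Y : V} {A B D : C} (f : X ⟶ EnrichedCategory.Hom A B)
    (g : Y ⟶ EnrichedCategory.Hom B D) : X ⊗ Y ⟶ EnrichedCategory.Hom A D :=
  (f ⊗ₘ g) ≫ eComp V A B D

lemma hcomp_comp {X Y X' Y' : V} {A B D : C} (a : X' ⟶ X) (b : Y' ⟶ Y)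
    (f : X ⟶ EnrichedCategory.Hom A B) (g : Y ⟶ EnrichedCategory.Hom B D) :
    hcomp (a ≫ f) (b ≫ g) = (a ⊗ₘ b) ≫ hcomp f g := by
  simp only [hcomp, ← MonoidalCategory.tensorHom_comp_tensorHom, Category.assoc]

lemma hcomp_comp_left {X Y X' : V} {A B D : C} (a : X' ⟶ X)
    (f : X ⟶ EnrichedCategory.Hom A B) (g : Y ⟶ EnrichedCategory.Hom B D) :
    hcomp (a ≫ f) g = a ▷ Y ≫ hcomp f g := by
  have := hcomp_comp a (𝟙 Y) f g
  rwa [Category.id_comp, MonoidalCategory.tensorHom_id] at this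

lemma hcomp_comp_right {X Y Y' : V} {A B D : C} (b : Y' ⟶ Y)
    (f : X ⟶ EnrichedCategory.Hom A B) (g : Y ⟶ EnrichedCategory.Hom B D) :
    hcomp f (b ≫ g) = X ◁ b ≫ hcomp f g := by
  have := hcomp_comp (𝟙 X) b f g
  rwa [Category.id_comp, MonoidalCategory.id_tensorHom] at this

lemma hcomp_assoc {X Y Z : V} {A B D E : C} (f : X ⟶ EnrichedCategory.Hom A B)
    (g : Y ⟶ EnrichedCategory.Hom B D) (h : Z ⟶ EnrichedCategory.Hom D E) :
    hcomp (hcomp f g) h = (α_ X Y Z).hom ≫ hcomp f (hcomp g h) := by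
  rw [hcomp, hcomp, hcomp, hcomp, ← MonoidalCategory.tensorHom_comp_whiskerRight,
    ← MonoidalCategory.tensorHom_comp_whiskerLeft, Category.assoc, Category.assoc, ← e_assoc',
    ← MonoidalCategory.associator_naturality_assoc]

lemma hcomp_eId {X : V} {A B : C} (f : X ⟶ EnrichedCategory.Hom A B) :
    hcomp f (eId V B) = (ρ_ X).hom ≫ f := by
  rw [hcomp, MonoidalCategory.tensorHom_def, Category.assoc, ← cancel_epi (ρ_ X).inv,
    Iso.inv_hom_id_assoc, ← rightUnitor_inv_naturality_assoc, e_comp_id, Category.comp_id]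

lemma eId_hcomp {X : V} {A B : C} (f : X ⟶ EnrichedCategory.Hom A B) :
    hcomp (eId V A) f = (λ_ X).hom ≫ f := by
  rw [hcomp, MonoidalCategory.tensorHom_def', Category.assoc, ← cancel_epi (λ_ X).inv,
    Iso.inv_hom_id_assoc, ← leftUnitor_inv_naturality_assoc, e_id_comp, Category.comp_id]

lemma hcomp_id_id (A B D : C) :
    hcomp (𝟙 (EnrichedCategory.Hom A B : V)) (𝟙 (EnrichedCategory.Hom B D : V)) =
      eComp V A B D := by
  rw [hcomp, MonoidalCategory.id_tensorHom_id, Category.id_comp]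

variable [MonoidalClosed V] (F : EnrichedFunctor V C V)

lemma act_eId (A : C) : F.obj A ◁ eId V A ≫ act F A A = (ρ_ _).hom := by
  rw [act, ← MonoidalClosed.uncurry_natural_left, F.map_id]
  change MonoidalClosed.uncurry (MonoidalClosed.id _) = _
  rw [MonoidalClosed.id_eq, MonoidalClosed.uncurry_curry]

/-- The action of generalized elements of hom-objects on generalized elements of `F`. -/
def actOn {X Y : V} {A B : C} (t : X ⟶ F.obj A) (g : Y ⟶ EnrichedCategory.Hom A B) :
    X ⊗ Y ⟶ F.obj B :=
  (t ⊗ₘ g) ≫ act F A B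

lemma actOn_comp {X Y X' Y' : V} {A B : C} (a : X' ⟶ X) (b : Y' ⟶ Y)
    (f : X ⟶ F.obj A) (g : Y ⟶ EnrichedCategory.Hom A B) :
    actOn F (a ≫ f) (b ≫ g) = (a ⊗ₘ b) ≫ actOn F f g := by
  simp only [actOn, ← MonoidalCategory.tensorHom_comp_tensorHom, Category.assoc]

lemma actOn_comp_left {X Y X' : V} {A B : C} (a : X' ⟶ X)
    (f : X ⟶ F.obj A) (g : Y ⟶ EnrichedCategory.Hom A B) :
    actOn F (a ≫ f) g = a ▷ Y ≫ actOn F f g := by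
  have := actOn_comp F a (𝟙 Y) f g
  rwa [Category.id_comp, MonoidalCategory.tensorHom_id] at this

lemma actOn_comp_right {X Y Y' : V} {A B : C} (b : Y' ⟶ Y)
    (f : X ⟶ F.obj A) (g : Y ⟶ EnrichedCategory.Hom A B) :
    actOn F f (b ≫ g) = X ◁ b ≫ actOn F f g := by
  have := actOn_comp F (𝟙 X) b f g
  rwa [Category.id_comp, MonoidalCategory.id_tensorHom] at this

lemma actOn_eId {X : V} {A : C} (t : X ⟶ F.obj A) :
    actOn F t (eId V A) = (ρ_ X).hom ≫ t := by
  rw [actOn, MonoidalCategory.tensorHom_def, Category.assoc, act_eId, rightUnitor_naturality]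

variable {F} in
/-- A transformation of weights, with naturality checked on the transposed actions. -/
def WeightHom.ofAct {G : EnrichedFunctor V C V} (app : ∀ A, F.obj A ⟶ G.obj A)
    (h : ∀ A B, act F A B ≫ app B = app A ▷ _ ≫ act G A B) : WeightHom F G where
  app := app
  naturality A B := by
    apply MonoidalClosed.uncurry_injective
    rw [MonoidalClosed.uncurry_pre_app]
    exact (MonoidalClosed.uncurry_natural_right _ _).trans (h A B)

/-- The action of a generalized element `g` of `C(A,B)` on a global element `x` of `F A`; for `g`
the identity this is the Yoneda transform `C(A,B) ⟶ F B` of `x`. -/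
def evalAt {Y : V} {A B : C} (x : 𝟙_ V ⟶ F.obj A) (g : Y ⟶ EnrichedCategory.Hom A B) :
    Y ⟶ F.obj B :=
  (λ_ Y).inv ≫ actOn F x g

lemma actOn_unit {Y : V} {A B : C} (x : 𝟙_ V ⟶ F.obj A) (g : Y ⟶ EnrichedCategory.Hom A B) :
    actOn F x g = (λ_ Y).hom ≫ evalAt F x g := by
  rw [evalAt, Iso.hom_inv_id_assoc]

lemma evalAt_comp {Y Y' : V} {A B : C} (x : 𝟙_ V ⟶ F.obj A) (a : Y' ⟶ Y)
    (g : Y ⟶ EnrichedCategory.Hom A B) : evalAt F x (a ≫ g) = a ≫ evalAt F x g := by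
  rw [evalAt, evalAt, actOn_comp_right, leftUnitor_inv_naturality_assoc]

lemma evalAt_eId {A : C} (x : 𝟙_ V ⟶ F.obj A) : evalAt F x (eId V A) = x := by
  rw [evalAt, actOn_eId, ← unitors_equal, Iso.inv_hom_id_assoc]

variable [SymmetricCategory V]

lemma act_eComp (A B D : C) : F.obj A ◁ eComp V A B D ≫ act F A D =
    (α_ _ _ _).inv ≫ act F A B ▷ _ ≫ act F B D := by
  rw [act, ← MonoidalClosed.uncurry_natural_left, F.map_comp]
  exact uncurry_eComp _ _

lemma actOn_assoc {X Y Z : V} {A B D : C} (t : X ⟶ F.obj A)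
    (g : Y ⟶ EnrichedCategory.Hom A B) (h : Z ⟶ EnrichedCategory.Hom B D) :
    actOn F (actOn F t g) h = (α_ X Y Z).hom ≫ actOn F t (hcomp g h) := by
  rw [actOn, actOn, actOn, hcomp, ← MonoidalCategory.tensorHom_comp_whiskerRight,
    ← MonoidalCategory.tensorHom_comp_whiskerLeft, Category.assoc, Category.assoc, act_eComp,
    ← MonoidalCategory.associator_naturality_assoc,
    Iso.hom_inv_id_assoc]

lemma evalAt_hcomp {Y Z : V} {A B D : C} (x : 𝟙_ V ⟶ F.obj A)
    (g : Y ⟶ EnrichedCategory.Hom A B) (h : Z ⟶ EnrichedCategory.Hom B D) :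
    evalAt F x (hcomp g h) = actOn F (evalAt F x g) h := by
  rw [evalAt, evalAt, actOn_comp_left, actOn_assoc]
  simp

lemma evalAt_hcomp_of_eq {Y Z : V} {A B D : C} {x : 𝟙_ V ⟶ F.obj A} {y : 𝟙_ V ⟶ F.obj B}
    {z : 𝟙_ V ⟶ F.obj D}
    {g : Y ⟶ EnrichedCategory.Hom A B} {h : Z ⟶ EnrichedCategory.Hom B D} {a : Y ⟶ 𝟙_ V}
    {b : Z ⟶ 𝟙_ V} (hg : evalAt F x g = a ≫ y) (hh : evalAt F y h = b ≫ z) :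
    evalAt F x (hcomp g h) = (a ⊗ₘ b) ≫ (λ_ _).hom ≫ z := by
  rw [evalAt_hcomp, hg, actOn_comp_left, actOn_unit, hh, MonoidalCategory.tensorHom_def]
  simp

/-- The `V`-functor to `V` given by an action of the hom-objects. -/
@[reducible]
def functorOfAct (obj : C → V) (a : ∀ A B, obj A ⊗ EnrichedCategory.Hom A B ⟶ obj B)
    (ha : ∀ A, obj A ◁ eId V A ≫ a A A = (ρ_ _).hom)
    (hc : ∀ A B D, obj A ◁ eComp V A B D ≫ a A D = (α_ _ _ _).inv ≫ a A B ▷ _ ≫ a B D) :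
    EnrichedFunctor V C V where
  obj := obj
  map A B := MonoidalClosed.curry (a A B)
  map_id A := by
    rw [← MonoidalClosed.curry_natural_left, ha]
    exact (MonoidalClosed.id_eq _).symm
  map_comp A B D := by
    apply MonoidalClosed.uncurry_injective
    erw [uncurry_eComp]
    rw [MonoidalClosed.uncurry_natural_left, MonoidalClosed.uncurry_curry,
      MonoidalClosed.uncurry_curry, MonoidalClosed.uncurry_curry, hc]

lemma act_functorOfAct (obj : C → V) (a : ∀ A B, obj A ⊗ EnrichedCategory.Hom A B ⟶ obj B)
    (ha : ∀ A, obj A ◁ eId V A ≫ a A A = (ρ_ _).hom)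
    (hc : ∀ A B D, obj A ◁ eComp V A B D ≫ a A D = (α_ _ _ _).inv ≫ a A B ▷ _ ≫ a B D) (A B : C) :
    act (functorOfAct obj a ha hc) A B = a A B :=
  MonoidalClosed.uncurry_curry _

end Calculus

section Families

variable [SymmetricCategory V] [MonoidalClosed V]

/-- Naturality in `i` of a family of morphisms `Z ⊗ Q i ⟶ G i`; such families are the generalized
elements of `[D,V](Q,G)`, see `natFamily`. -/
def IsNatFamily {D : Type w} [EnrichedCategory V D] (Q G : EnrichedFunctor V D V) {Z : V}
    (t : ∀ i, Z ⊗ Q.obj i ⟶ G.obj i) : Prop :=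
  ∀ i j, t i ▷ EnrichedCategory.Hom i j ≫ act G i j = (α_ _ _ _).hom ≫ Z ◁ act Q i j ≫ t j

lemma isNatFamily_iff {D : Type w} [EnrichedCategory V D] {Q G : EnrichedFunctor V D V} {Z : V}
    {t : ∀ i, Z ⊗ Q.obj i ⟶ G.obj i} : IsNatFamily Q G t ↔ ∀ i j,
      _ ◁ (β_ _ _).hom ≫ (α_ _ _ _).inv ≫ ((β_ _ _).hom ≫ t i) ▷ _ ≫ act G i j =
        (α_ _ _ _).inv ≫ act Q i j ▷ Z ≫ (β_ _ _).hom ≫ t j := by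
  refine forall₂_congr fun i j => ?_
  rw [← cancel_epi ((α_ Z (Q.obj i) (EnrichedCategory.Hom i j)).hom ≫
    (β_ Z (Q.obj i ⊗ EnrichedCategory.Hom i j)).hom ≫ (α_ _ _ _).hom) (g := _ ◁ _ ≫ _)]
  refine Eq.congr ?_ ?_
  · simp only [BraidedCategory.braiding_tensor_right_hom, Category.assoc, Iso.inv_hom_id_assoc,
      Iso.hom_inv_id_assoc, comp_whiskerRight]
    rw [← MonoidalCategory.whiskerLeft_comp_assoc, SymmetricCategory.symmetry,
      MonoidalCategory.whiskerLeft_id, Category.id_comp, Iso.hom_inv_id_assoc,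
      ← comp_whiskerRight_assoc, SymmetricCategory.symmetry, id_whiskerRight, Category.id_comp]
  · simp only [Category.assoc, Iso.hom_inv_id_assoc]
    rw [← BraidedCategory.braiding_naturality_right_assoc, SymmetricCategory.symmetry_assoc]

lemma WeightHom.isNatFamily {D : Type w} [EnrichedCategory V D] {Q G : EnrichedFunctor V D V}
    (φ : WeightHom Q G) : IsNatFamily Q G fun i => (λ_ _).hom ≫ φ.app i := by
  intro i j
  rw [comp_whiskerRight, Category.assoc, ← φ.act_comp]
  simp

variable [HasLimits V] {D : Type v} [EnrichedCategory V D]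

lemma natObj_hom_ext {F G : EnrichedFunctor V D V} {A : V} {f g : A ⟶ natObj F G}
    (h : ∀ X, f ≫ natObjπ F G X = g ≫ natObjπ F G X) : f = g := by
  apply equalizer.hom_ext
  apply Pi.hom_ext
  intro X
  exact (Category.assoc _ _ _).trans ((h X).trans (Category.assoc _ _ _).symm)

variable (Q G : EnrichedFunctor V D V)

/-- The family `Z ⊗ Q i ⟶ G i` corresponding to a generalized element of `[D,V](Q,G)`. -/
def natFamily {Z : V} (f : Z ⟶ natObj Q G) (i : D) : Z ⊗ Q.obj i ⟶ G.obj i :=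
  (β_ _ _).hom ≫ MonoidalClosed.uncurry (f ≫ natObjπ Q G i)

lemma natFamily_comp {Z Z' : V} (a : Z' ⟶ Z) (f : Z ⟶ natObj Q G) (i : D) :
    natFamily Q G (a ≫ f) i = a ▷ _ ≫ natFamily Q G f i := by
  rw [natFamily, natFamily, Category.assoc, MonoidalClosed.uncurry_natural_left]
  simp

variable {Q G}

lemma natFamily_ext {Z : V} {f g : Z ⟶ natObj Q G}
    (h : ∀ i, natFamily Q G f i = natFamily Q G g i) : f = g :=
  natObj_hom_ext fun i => MonoidalClosed.uncurry_injective ((cancel_epi (β_ _ _).hom).1 (h i))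

lemma isNatFamily_natFamily {Z : V} (f : Z ⟶ natObj Q G) :
    IsNatFamily Q G (natFamily Q G f) := by
  rw [isNatFamily_iff]
  intro i j
  have wedge := (wedge_iff Q G (fun i => f ≫ natObjπ Q G i) i j).1
    (by simp only [Category.assoc, natObjπ_wedge])
  simpa [natFamily] using wedge

lemma exists_natFamily_eq {Z : V} {t : ∀ i, Z ⊗ Q.obj i ⟶ G.obj i} (ht : IsNatFamily Q G t) :
    ∃ f : Z ⟶ natObj Q G, ∀ i, natFamily Q G f i = t i := by
  refine ⟨natObjLift Q G (fun i => MonoidalClosed.curry ((β_ _ _).hom ≫ t i)) fun i j => ?_, ?_⟩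
  · refine (wedge_iff Q G (fun i => MonoidalClosed.curry ((β_ _ _).hom ≫ t i)) i j).2 ?_
    simp only [MonoidalClosed.uncurry_curry]
    exact isNatFamily_iff.1 ht i j
  · intro i
    rw [natFamily, natObjLift_π, MonoidalClosed.uncurry_curry, SymmetricCategory.symmetry_assoc]

lemma natFamily_natObjMap {G' : EnrichedFunctor V D V} (p : WeightHom G G') {Z : V}
    (f : Z ⟶ natObj Q G) (i : D) :
    natFamily Q G' (f ≫ natObjMap Q p) i = natFamily Q G f i ≫ p.app i := by
  rw [natFamily, natFamily, natObjMap, Category.assoc, natObjLift_π, ← Category.assoc f,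
    MonoidalClosed.uncurry_natural_right, Category.assoc]

end Families

section NatFunctor

variable [SymmetricCategory V] {C : Type u'} [EnrichedCategory V C]

lemma braided_wedge_iff {A P R : C} {E X Y Z : V} (s : E ⟶ EnrichedCategory.Hom R P)
    (a : X ⊗ E ⟶ Y) (t : X ⊗ Z ⟶ EnrichedCategory.Hom P A)
    (t' : Y ⊗ Z ⟶ EnrichedCategory.Hom R A) :
    (X ◁ (β_ E Z).hom ≫ (α_ _ _ _).inv ≫ t ▷ _ ≫ _ ◁ s ≫ (β_ _ _).hom ≫ eComp V R P A =
      (α_ _ _ _).inv ≫ a ▷ Z ≫ t') ↔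
    hcomp s t = (α_ _ _ _).inv ≫ ((β_ E X).hom ≫ a) ▷ Z ≫ t' := by
  rw [← cancel_epi ((α_ E X Z).inv ≫ (β_ E X).hom ▷ Z ≫ (α_ _ _ _).hom)]
  refine Eq.congr ?_ (by simp)
  simp only [Category.assoc]
  rw [← reassoc_of% BraidedCategory.braiding_tensor_right_hom E X Z,
    ← BraidedCategory.braiding_naturality_right_assoc,
    ← BraidedCategory.braiding_naturality_left_assoc, SymmetricCategory.symmetry_assoc, hcomp,
    MonoidalCategory.tensorHom_def', Category.assoc]

variable [MonoidalClosed V]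

lemma act_homTo {D : Type w} [EnrichedCategory V D] (S : EnrichedFunctor V D C) (A : C)
    (X Y : Dᵒᵖ) : act (homTo S A) X Y =
      _ ◁ S.map Y.unop X.unop ≫ (β_ _ _).hom ≫ eComp V (S.obj Y.unop) (S.obj X.unop) A :=
  (act_comp_functor (opFunctor S) (yo A) X Y).trans
    (congrArg (fun f => _ ◁ S.map Y.unop X.unop ≫ f) (act_yo A _ _))

/-- The action of a weight `W : Dᵒᵖ → V`, written on the left. -/
def leftAct {D : Type w} [EnrichedCategory V D] (W : EnrichedFunctor V Dᵒᵖ V) (X Y : Dᵒᵖ) :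
    EnrichedCategory.Hom Y.unop X.unop ⊗ W.obj X ⟶ W.obj Y :=
  (β_ (EnrichedCategory.Hom Y.unop X.unop) (W.obj X)).hom ≫ act W X Y

/-- Naturality in `X` of a family `W X ⊗ Z ⟶ C(S X, A)`; such families are the generalized
elements of `[Dᵒᵖ,V](W, C(S-,A))`, see `leftFamily`. -/
def IsLeftNatFamily {D : Type w} [EnrichedCategory V D] (W : EnrichedFunctor V Dᵒᵖ V)
    (S : EnrichedFunctor V D C) {A : C} {Z : V}
    (t : ∀ X : Dᵒᵖ, W.obj X ⊗ Z ⟶ EnrichedCategory.Hom (S.obj X.unop) A) : Prop :=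
  ∀ X Y : Dᵒᵖ, hcomp (S.map Y.unop X.unop) (t X) = (α_ _ _ _).inv ≫ leftAct W X Y ▷ Z ≫ t Y

lemma isLeftNatFamily_iff {D : Type w} [EnrichedCategory V D] {W : EnrichedFunctor V Dᵒᵖ V}
    {S : EnrichedFunctor V D C} {A : C} {Z : V}
    {t : ∀ X : Dᵒᵖ, W.obj X ⊗ Z ⟶ EnrichedCategory.Hom (S.obj X.unop) A} :
    IsLeftNatFamily W S t ↔ ∀ X Y : Dᵒᵖ,
      W.obj X ◁ (β_ (EnrichedCategory.Hom X Y) Z).hom ≫ (α_ _ _ _).inv ≫ t X ▷ _ ≫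
        act (homTo S A) X Y = (α_ _ _ _).inv ≫ act W X Y ▷ Z ≫ t Y := by
  refine forall₂_congr fun X Y => ?_
  refine (braided_wedge_iff (S.map Y.unop X.unop) (act W X Y) (t X) (t Y)).symm.trans ?_
  exact Eq.congr_left (congrArg (fun f => W.obj X ◁ (β_ (EnrichedCategory.Hom X Y) Z).hom ≫
    (α_ _ _ _).inv ≫ t X ▷ _ ≫ f) (act_homTo S A X Y)).symm

lemma IsLeftNatFamily.hcomp_right {D : Type w} [EnrichedCategory V D]
    {W : EnrichedFunctor V Dᵒᵖ V} {S : EnrichedFunctor V D C} {A B : C} {Z Z' : V}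
    {t : ∀ X : Dᵒᵖ, W.obj X ⊗ Z ⟶ EnrichedCategory.Hom (S.obj X.unop) A}
    (ht : IsLeftNatFamily W S t) (g : Z' ⟶ EnrichedCategory.Hom A B) :
    IsLeftNatFamily W S (fun X => (α_ _ _ _).inv ≫ hcomp (t X) g) := by
  intro X Y
  have h := congrArg (fun s => hcomp s g) (ht X Y)
  simp only [hcomp_assoc, hcomp_comp_left] at h
  rw [hcomp_comp_right, ← cancel_epi (EnrichedCategory.Hom Y.unop X.unop ◁ (α_ _ _ _).hom),
    ← MonoidalCategory.whiskerLeft_comp_assoc, Iso.hom_inv_id, MonoidalCategory.whiskerLeft_id,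
    Category.id_comp, ← cancel_epi (α_ _ _ _).hom, h]
  simp

variable [HasLimits V] {D : Type v} [EnrichedCategory V D] {W : EnrichedFunctor V Dᵒᵖ V}
  {S : EnrichedFunctor V D C}

/-- The family `W X ⊗ Z ⟶ C(S X, A)` corresponding to a generalized element of
`[Dᵒᵖ,V](W, C(S-,A))`. -/
def leftFamily {A : C} {Z : V} (f : Z ⟶ natObj W (homTo S A)) (X : Dᵒᵖ) :
    W.obj X ⊗ Z ⟶ EnrichedCategory.Hom (S.obj X.unop) A :=
  MonoidalClosed.uncurry (f ≫ natObjπ W (homTo S A) X)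

lemma leftFamily_comp {A : C} {Z Z' : V} (a : Z' ⟶ Z) (f : Z ⟶ natObj W (homTo S A)) (X : Dᵒᵖ) :
    leftFamily (a ≫ f) X = _ ◁ a ≫ leftFamily f X :=
  (congrArg MonoidalClosed.uncurry (Category.assoc a f (natObjπ W (homTo S A) X))).trans
    (MonoidalClosed.uncurry_natural_left _ _)

lemma leftFamily_eq {A : C} {Z : V} (f : Z ⟶ natObj W (homTo S A)) (X : Dᵒᵖ) :
    leftFamily f X = _ ◁ f ≫ leftFamily (𝟙 _) X := by
  rw [← leftFamily_comp, Category.comp_id]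

lemma leftFamily_ext {A : C} {Z : V} {f g : Z ⟶ natObj W (homTo S A)}
    (h : ∀ X, leftFamily f X = leftFamily g X) : f = g :=
  natObj_hom_ext fun X => MonoidalClosed.uncurry_injective (h X)

lemma isLeftNatFamily_leftFamily {A : C} {Z : V} (f : Z ⟶ natObj W (homTo S A)) :
    IsLeftNatFamily W S (leftFamily f) :=
  isLeftNatFamily_iff.2 fun X Y => (wedge_iff W (homTo S A) (fun i => f ≫ natObjπ W _ i) X Y).1
    (by simp only [Category.assoc, natObjπ_wedge])

/-- The generalized element of `[Dᵒᵖ,V](W, C(S-,A))` corresponding to a natural family. -/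
def leftLift {A : C} {Z : V}
    (t : ∀ X : Dᵒᵖ, W.obj X ⊗ Z ⟶ EnrichedCategory.Hom (S.obj X.unop) A)
    (ht : IsLeftNatFamily W S t) : Z ⟶ natObj W (homTo S A) :=
  natObjLift W (homTo S A) (fun X => MonoidalClosed.curry (t X)) fun X Y => by
    refine (wedge_iff W (homTo S A) (fun X => MonoidalClosed.curry (t X)) X Y).2 ?_
    have h (X : Dᵒᵖ) : MonoidalClosed.uncurry (MonoidalClosed.curry (t X)) = t X :=
      MonoidalClosed.uncurry_curry _
    exact (isLeftNatFamily_iff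
      (t := fun X => MonoidalClosed.uncurry (MonoidalClosed.curry (t X)))).1
      (by simpa only [h] using ht) X Y

@[simp]
lemma leftFamily_leftLift {A : C} {Z : V}
    (t : ∀ X : Dᵒᵖ, W.obj X ⊗ Z ⟶ EnrichedCategory.Hom (S.obj X.unop) A)
    (ht : IsLeftNatFamily W S t) (X : Dᵒᵖ) : leftFamily (leftLift t ht) X = t X :=
  (congrArg MonoidalClosed.uncurry (natObjLift_π W (homTo S A) _ _ X)).trans
    (MonoidalClosed.uncurry_curry _)

variable (W S)

/-- The action of `C(A,B)` on `[Dᵒᵖ,V](W, C(S-,A))` by composition. -/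
def natAct (A B : C) :
    natObj W (homTo S A) ⊗ EnrichedCategory.Hom A B ⟶ natObj W (homTo S B) :=
  leftLift _ ((isLeftNatFamily_leftFamily (𝟙 _)).hcomp_right (𝟙 _))

variable {W S}

lemma leftFamily_tensorHom_natAct {A B : C} {Z Z' : V} (f : Z ⟶ natObj W (homTo S A))
    (g : Z' ⟶ EnrichedCategory.Hom A B) (X : Dᵒᵖ) :
    leftFamily ((f ⊗ₘ g) ≫ natAct W S A B) X = (α_ _ _ _).inv ≫ hcomp (leftFamily f X) g := by
  rw [leftFamily_comp, natAct, leftFamily_leftLift, leftFamily_eq f]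
  conv_rhs => rw [← Category.comp_id g, hcomp_comp]
  simp [MonoidalCategory.tensorHom_def]

variable (W S)

/-- The `V`-functor `A ↦ [Dᵒᵖ,V](W, C(S-,A))`. -/
@[reducible]
def natFunctor : EnrichedFunctor V C V :=
  functorOfAct (fun A => natObj W (homTo S A)) (natAct W S)
    (fun A => leftFamily_ext fun X => by
      rw [← MonoidalCategory.id_tensorHom, leftFamily_tensorHom_natAct, hcomp_eId,
        leftFamily_eq (ρ_ _).hom]
      simp)
    (fun A B E => leftFamily_ext fun X => by
      have h := leftFamily_tensorHom_natAct (W := W) (S := S)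
        (𝟙 (natObj W (homTo S A))) (𝟙 (EnrichedCategory.Hom A B)) X
      rw [MonoidalCategory.id_tensorHom_id, Category.id_comp] at h
      rw [← MonoidalCategory.id_tensorHom, leftFamily_tensorHom_natAct, leftFamily_comp,
        ← MonoidalCategory.tensorHom_id, leftFamily_tensorHom_natAct, h, hcomp_comp_left,
        hcomp_assoc, hcomp_id_id]
      simp)

variable {W S}

lemma leftFamily_actOn {A B : C} {Z Z' : V} (t : Z ⟶ (natFunctor W S).obj A)
    (g : Z' ⟶ EnrichedCategory.Hom A B) (X : Dᵒᵖ) :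
    leftFamily (actOn (natFunctor W S) t g) X = (α_ _ _ _).inv ≫ hcomp (leftFamily t X) g := by
  rw [actOn, act_functorOfAct]
  exact leftFamily_tensorHom_natAct t g X

end NatFunctor

section Limiting

variable [SymmetricCategory V] [MonoidalClosed V] {C : Type u'} [EnrichedCategory V C]

section
variable {D : Type w} [EnrichedCategory V D]
  {Q : EnrichedFunctor V D V} {S : EnrichedFunctor V D C} {L : C}

/-- The component at `i` of a cone `Q ⟶ C(L,S-)`, typed as a generalized element of
`C(L, S i)`. -/
def coneApp (η : WeightHom Q (homFrom S L)) (i : D) : Q.obj i ⟶ EnrichedCategory.Hom L (S.obj i) :=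
  η.app i

lemma whiskerRight_act_homFrom {B : C} {X : V} (i j : D)
    (t : X ⟶ EnrichedCategory.Hom B (S.obj i)) :
    t ▷ _ ≫ act (homFrom S B) i j = hcomp t (S.map i j) := by
  rw [hcomp, MonoidalCategory.tensorHom_def, Category.assoc]
  exact congrArg (fun f => t ▷ _ ≫ f) ((act_comp_functor S (coyo B) i j).trans
    (congrArg (fun f => _ ◁ S.map i j ≫ f) (act_coyo (V := V) B (S.obj i) (S.obj j))))

lemma act_coneApp (η : WeightHom Q (homFrom S L)) (i j : D) :
    act Q i j ≫ coneApp η j = hcomp (coneApp η i) (S.map i j) :=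
  (η.act_comp i j).trans (whiskerRight_act_homFrom i j (coneApp η i))

/-- `F` sends the cone `η : Q ⟶ C(L,S-)` to a weighted limit; this is stated on generalized
elements, so that it makes sense without the object of `V`-natural transformations. -/
def IsLimiting (F : EnrichedFunctor V C V) (η : WeightHom Q (homFrom S L)) : Prop :=
  ∀ ⦃Z : V⦄ (t : ∀ i, Z ⊗ Q.obj i ⟶ F.obj (S.obj i)),
    (∀ i j, actOn F (t i) (S.map i j) = (α_ _ _ _).hom ≫ Z ◁ act Q i j ≫ t j) →
    ∃! g : Z ⟶ F.obj L, ∀ i, actOn F g (coneApp η i) = t i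

/-- The cone `η : Q ⟶ C(L,S-)` is a weighted limit, stated on generalized elements. -/
def IsLimitCone (η : WeightHom Q (homFrom S L)) : Prop :=
  ∀ ⦃B : C⦄ ⦃Z : V⦄ (t : ∀ i, Z ⊗ Q.obj i ⟶ EnrichedCategory.Hom B (S.obj i)),
    (∀ i j, hcomp (t i) (S.map i j) = (α_ _ _ _).hom ≫ Z ◁ act Q i j ≫ t j) →
    ∃! g : Z ⟶ EnrichedCategory.Hom B L, ∀ i, hcomp g (coneApp η i) = t i

lemma IsLimiting.hom_ext {F : EnrichedFunctor V C V} {η : WeightHom Q (homFrom S L)}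
    (h : IsLimiting F η) {Z : V} {g g' : Z ⟶ F.obj L}
    (hg : ∀ i, actOn F g (coneApp η i) = actOn F g' (coneApp η i)) : g = g' := by
  refine (h (fun i => actOn F g (coneApp η i)) fun i j => ?_).unique (fun _ => rfl)
    fun i => (hg i).symm
  rw [actOn_assoc, ← act_coneApp, actOn_comp_right]

lemma IsLimitCone.hom_ext {η : WeightHom Q (homFrom S L)}
    (h : IsLimitCone η) {B : C} {Z : V} {g g' : Z ⟶ EnrichedCategory.Hom B L}
    (hg : ∀ i, hcomp g (coneApp η i) = hcomp g' (coneApp η i)) : g = g' := by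
  refine (h (fun i => hcomp g (coneApp η i)) fun i j => ?_).unique (fun _ => rfl)
    fun i => (hg i).symm
  rw [hcomp_assoc, ← act_coneApp, hcomp_comp_right]

variable [HasLimits V]

lemma IsLimitCone.natFunctor {η : WeightHom Q (homFrom S L)}
    (hη : IsLimitCone η) {E : Type v} [EnrichedCategory V E]
    (W : EnrichedFunctor V Eᵒᵖ V) (T : EnrichedFunctor V E C) :
    IsLimiting (natFunctor W T) η := by
  intro Z t ht
  have compatible (X : Eᵒᵖ) (i j : D) :
      hcomp ((α_ (W.obj X) Z (Q.obj i)).hom ≫ leftFamily (t i) X) (S.map i j) =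
        (α_ _ _ _).hom ≫ _ ◁ act Q i j ≫ (α_ (W.obj X) Z (Q.obj j)).hom ≫ leftFamily (t j) X := by
    have h := congrArg (fun s => leftFamily s X) (ht i j)
    simp only [leftFamily_actOn, leftFamily_comp, Iso.inv_comp_eq] at h
    rw [hcomp_comp_left, h]
    simp
  choose g hg hg_unique using fun X => hη _ (compatible X)
  have hg_apply (X : Eᵒᵖ) (i : D) : hcomp (g X) (coneApp η i) =
      (α_ (W.obj X) Z (Q.obj i)).hom ≫ leftFamily (t i) X := hg X i
  have hnat : IsLeftNatFamily W T g := fun X Y => hη.hom_ext fun i => by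
    rw [hcomp_assoc, hg_apply, hcomp_comp_right, isLeftNatFamily_leftFamily (t i) X Y,
      hcomp_comp_left, hcomp_comp_left, hg_apply]
    simp
  refine ⟨leftLift g hnat, fun i => leftFamily_ext fun X => ?_,
    fun g' hg' => leftFamily_ext fun X => ?_⟩
  · rw [leftFamily_actOn, leftFamily_leftLift, hg_apply, Iso.inv_hom_id_assoc]
  · rw [leftFamily_leftLift]
    refine hg_unique X _ fun i => ?_
    have h := congrArg (fun s => leftFamily s X) (hg' i)
    simp only [leftFamily_actOn] at h
    rw [← h, Iso.hom_inv_id_assoc]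

end

section
variable [HasLimits V] {D : Type v} [EnrichedCategory V D]
  {Q : EnrichedFunctor V D V} {S : EnrichedFunctor V D C} {L : C}

lemma natFamily_limitMap (η : WeightHom Q (homFrom S L)) (B : C) {Z : V}
    (g : Z ⟶ EnrichedCategory.Hom B L) (i : D) :
    natFamily Q (homFrom S B) (g ≫ limitMap η B) i = hcomp g (coneApp η i) := by
  have hlimit : natFamily Q (homFrom S B) (limitMap η B) i =
      _ ◁ coneApp η i ≫ eComp V B L (S.obj i) := by
    have hπ : limitMap η B ≫ natObjπ Q (homFrom S B) i = MonoidalClosed.curry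
        (coneApp η i ▷ _ ≫ (β_ _ _).hom ≫ eComp V B L (S.obj i)) := natObjLift_π _ _ _ _ i
    have hβ : (β_ (EnrichedCategory.Hom B L) (Q.obj i)).hom ≫ coneApp η i ▷ _ ≫ (β_ _ _).hom ≫
        eComp V B L (S.obj i) = _ ◁ coneApp η i ≫ eComp V B L (S.obj i) := by
      rw [← BraidedCategory.braiding_naturality_right_assoc, SymmetricCategory.symmetry_assoc]
    exact (congrArg (fun f => (β_ _ _).hom ≫ MonoidalClosed.uncurry f) hπ).trans
      ((congrArg (fun f => (β_ _ _).hom ≫ f) (MonoidalClosed.uncurry_curry _)).trans hβ)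
  rw [hcomp, MonoidalCategory.tensorHom_def, Category.assoc, natFamily_comp]
  exact congrArg (fun f => g ▷ _ ≫ f) hlimit

lemma isLimitCone_of_isIso_limitMap (η : WeightHom Q (homFrom S L))
    (hη : ∀ B, IsIso (limitMap η B)) : IsLimitCone η := by
  intro B Z t ht
  have hB := hη B
  have ht' : IsNatFamily Q (homFrom S B) t := fun i j =>
    (whiskerRight_act_homFrom i j (t i)).trans (ht i j)
  obtain ⟨f, hf⟩ := exists_natFamily_eq ht'
  refine ⟨f ≫ inv (limitMap η B), fun i => ?_, fun g hg => ?_⟩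
  · refine (natFamily_limitMap η B _ i).symm.trans ?_
    rw [Category.assoc, IsIso.inv_hom_id, Category.comp_id, hf]
  · rw [IsIso.eq_comp_inv]
    exact natFamily_ext fun i => (natFamily_limitMap η B g i).trans ((hg i).trans (hf i).symm)

end

section
variable {X : V} {P B : C}

/-- `F` sends `κ : X ⟶ C(P,B)` to a power, stated on generalized elements. -/
def IsPowering (F : EnrichedFunctor V C V) (κ : X ⟶ EnrichedCategory.Hom P B) : Prop :=
  ∀ ⦃Z : V⦄ (t : Z ⊗ X ⟶ F.obj B), ∃! g : Z ⟶ F.obj P, actOn F g κ = t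

/-- `κ : X ⟶ C(P,B)` exhibits `P` as a power, stated on generalized elements. -/
def IsPower (κ : X ⟶ EnrichedCategory.Hom P B) : Prop :=
  ∀ ⦃A : C⦄ ⦃Z : V⦄ (t : Z ⊗ X ⟶ EnrichedCategory.Hom A B),
    ∃! g : Z ⟶ EnrichedCategory.Hom A P, hcomp g κ = t

lemma hcomp_eq_uncurry_powerMap (κ : X ⟶ EnrichedCategory.Hom P B) (A : C) {Z : V}
    (g : Z ⟶ EnrichedCategory.Hom A P) :
    hcomp g κ = (β_ _ _).hom ≫ MonoidalClosed.uncurry (g ≫ powerMap κ A) := by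
  rw [powerMap, ← MonoidalClosed.curry_natural_left, MonoidalClosed.uncurry_curry, hcomp,
    MonoidalCategory.tensorHom_def, ← BraidedCategory.braiding_naturality_left_assoc,
    ← BraidedCategory.braiding_naturality_right_assoc, SymmetricCategory.symmetry_assoc,
    Category.assoc]

lemma isPower_of_isIso_powerMap (κ : X ⟶ EnrichedCategory.Hom P B)
    (hκ : ∀ A, IsIso (powerMap κ A)) : IsPower κ := by
  intro A Z t
  have hA := hκ A
  refine ⟨MonoidalClosed.curry ((β_ _ _).hom ≫ t) ≫ inv (powerMap κ A), ?_, fun g hg => ?_⟩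
  · refine (hcomp_eq_uncurry_powerMap κ A _).trans ?_
    rw [Category.assoc, IsIso.inv_hom_id, Category.comp_id, MonoidalClosed.uncurry_curry,
      SymmetricCategory.symmetry_assoc]
  · rw [IsIso.eq_comp_inv]
    apply MonoidalClosed.uncurry_injective
    rw [MonoidalClosed.uncurry_curry, ← cancel_epi (β_ _ _).hom, SymmetricCategory.symmetry_assoc,
      ← hg]
    exact (hcomp_eq_uncurry_powerMap κ A g).symm

lemma IsPower.natFunctor [HasLimits V] {κ : X ⟶ EnrichedCategory.Hom P B}
    (hκ : IsPower κ) {E : Type v} [EnrichedCategory V E]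
    (W : EnrichedFunctor V Eᵒᵖ V) (T : EnrichedFunctor V E C) :
    IsPowering (natFunctor W T) κ := by
  intro Z t
  choose g hg hg_unique using fun Y : Eᵒᵖ => hκ ((α_ (W.obj Y) Z X).hom ≫ leftFamily t Y)
  have hg_apply (Y : Eᵒᵖ) : hcomp (g Y) κ = (α_ (W.obj Y) Z X).hom ≫ leftFamily t Y := hg Y
  have hnat : IsLeftNatFamily W T g := by
    intro Y Y'
    apply (hκ _).unique rfl
    rw [hcomp_assoc, hg_apply, hcomp_comp_right, isLeftNatFamily_leftFamily t Y Y',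
      hcomp_comp_left, hcomp_comp_left, hg_apply]
    simp
  refine ⟨leftLift g hnat, leftFamily_ext fun Y => ?_, fun g' hg' => leftFamily_ext fun Y => ?_⟩
  · rw [leftFamily_actOn, leftFamily_leftLift, hg_apply, Iso.inv_hom_id_assoc]
  · rw [leftFamily_leftLift]
    refine hg_unique Y _ ?_
    have h := congrArg (fun s => leftFamily s Y) hg'
    simp only [leftFamily_actOn] at h
    rw [← h, Iso.hom_inv_id_assoc]

end

end Limiting

section Points

variable {C : Type u'} [EnrichedCategory V C]

/-- Precomposition `C(B,D) ⟶ C(A,D)` with a point of `C(A,B)`. -/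
def preComp {A B : C} (u : 𝟙_ V ⟶ EnrichedCategory.Hom A B) (D : C) :
    (EnrichedCategory.Hom B D : V) ⟶ EnrichedCategory.Hom A D :=
  (λ_ _).inv ≫ hcomp u (𝟙 _)

/-- Postcomposition `C(A,B) ⟶ C(A,D)` with a point of `C(B,D)`. -/
def postComp {B D : C} (u : 𝟙_ V ⟶ EnrichedCategory.Hom B D) (A : C) :
    (EnrichedCategory.Hom A B : V) ⟶ EnrichedCategory.Hom A D :=
  (ρ_ _).inv ≫ hcomp (𝟙 _) u

lemma comp_preComp {A B D : C} (u : 𝟙_ V ⟶ EnrichedCategory.Hom A B) {Y : V}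
    (g : Y ⟶ EnrichedCategory.Hom B D) : g ≫ preComp u D = (λ_ _).inv ≫ hcomp u g := by
  rw [preComp, leftUnitor_inv_naturality_assoc, ← hcomp_comp_right, Category.comp_id]

lemma comp_postComp {A B D : C} (u : 𝟙_ V ⟶ EnrichedCategory.Hom B D) {Y : V}
    (g : Y ⟶ EnrichedCategory.Hom A B) : g ≫ postComp u A = (ρ_ _).inv ≫ hcomp g u := by
  rw [postComp, rightUnitor_inv_naturality_assoc, ← hcomp_comp_left, Category.comp_id]

lemma hcomp_point {A B D : C} (u : 𝟙_ V ⟶ EnrichedCategory.Hom A B) {Y : V}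
    (g : Y ⟶ EnrichedCategory.Hom B D) : hcomp u g = (λ_ _).hom ≫ g ≫ preComp u D := by
  rw [comp_preComp, Iso.hom_inv_id_assoc]

lemma hcomp_preComp {A B D E : C} (u : 𝟙_ V ⟶ EnrichedCategory.Hom A B) {X Y : V}
    (f : X ⟶ EnrichedCategory.Hom B D) (g : Y ⟶ EnrichedCategory.Hom D E) :
    hcomp (f ≫ preComp u D) g = hcomp f g ≫ preComp u E := by
  rw [comp_preComp, comp_preComp, hcomp_comp_left, hcomp_assoc]
  simp

lemma preComp_preComp {A B D : C} (u : 𝟙_ V ⟶ EnrichedCategory.Hom A B)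
    (w : 𝟙_ V ⟶ EnrichedCategory.Hom B D) (E : C) :
    preComp (w ≫ preComp u D) E = preComp w E ≫ preComp u E := by
  rw [preComp, hcomp_preComp, ← Category.assoc]
  rfl

lemma point_postComp {A B D : C} (u : 𝟙_ V ⟶ EnrichedCategory.Hom A B)
    (w : 𝟙_ V ⟶ EnrichedCategory.Hom B D) : u ≫ postComp w A = w ≫ preComp u D := by
  rw [comp_preComp, comp_postComp, unitors_inv_equal]

lemma eId_postComp {A B : C} (u : 𝟙_ V ⟶ EnrichedCategory.Hom A B) :
    eId V A ≫ postComp u A = u := by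
  rw [comp_postComp, eId_hcomp, unitors_equal, Iso.inv_hom_id_assoc]

variable [MonoidalClosed V] (F : EnrichedFunctor V C V)

/-- The map `C(A,B) ⟶ F B` given by evaluation at `x : I ⟶ F A`. -/
def evalMap {A : C} (x : 𝟙_ V ⟶ F.obj A) (B : C) :
    (EnrichedCategory.Hom A B : V) ⟶ F.obj B :=
  evalAt F x (𝟙 _)

lemma comp_evalMap {A B : C} (x : 𝟙_ V ⟶ F.obj A) {Y : V} (g : Y ⟶ EnrichedCategory.Hom A B) :
    g ≫ evalMap F x B = evalAt F x g := by
  rw [evalMap, ← evalAt_comp, Category.comp_id]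

variable [SymmetricCategory V]

lemma evalAt_preComp {A B D : C} (x : 𝟙_ V ⟶ F.obj A) (u : 𝟙_ V ⟶ EnrichedCategory.Hom A B)
    {Y : V} (g : Y ⟶ EnrichedCategory.Hom B D) :
    evalAt F x (g ≫ preComp u D) = evalAt F (evalAt F x u) g := by
  rw [comp_preComp, evalAt_comp, evalAt_hcomp, actOn_unit, Iso.inv_hom_id_assoc]

lemma preComp_evalMap {A B : C} (x : 𝟙_ V ⟶ F.obj A) (u : 𝟙_ V ⟶ EnrichedCategory.Hom A B)
    (D : C) : preComp u D ≫ evalMap F x D = evalMap F (evalAt F x u) D := by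
  have h := evalAt_preComp F x u (𝟙 (EnrichedCategory.Hom B D))
  rwa [Category.id_comp, ← comp_evalMap] at h

lemma postComp_evalMap {A B D : C} (x : 𝟙_ V ⟶ F.obj A) (u : 𝟙_ V ⟶ EnrichedCategory.Hom B D) :
    postComp u A ≫ evalMap F x D = evalMap F x B ≫ (ρ_ _).inv ≫ actOn F (𝟙 _) u := by
  rw [comp_evalMap, postComp, evalAt_comp, evalAt_hcomp, evalMap, rightUnitor_inv_naturality_assoc,
    ← actOn_comp_left, Category.comp_id]

end Points

section Homotopy

variable [ModelCategory V]

lemma exists_interval {T : V} (d c : 𝟙_ V ⟶ T) (e : T ⟶ 𝟙_ V) (hd : d ≫ e = 𝟙 _)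
    (hc : c ≫ e = 𝟙 _) [WeakEquivalence e] :
    ∃ (j : Interval V) (p : j.J ⟶ T), j.d ≫ p = d ∧ j.c ≫ p = c ∧ p ≫ e = j.e := by
  let φ := MorphismProperty.factorizationData (cofibrations V) (trivialFibrations V)
    (coprod.desc d c)
  have hinl : coprod.inl ≫ φ.i ≫ φ.p = d := by rw [φ.fac, coprod.inl_desc]
  have hinr : coprod.inr ≫ φ.i ≫ φ.p = c := by rw [φ.fac, coprod.inr_desc]
  have : WeakEquivalence φ.p := ((mem_trivialFibrations_iff _).1 φ.hp).2
  have hi : coprod.desc (coprod.inl ≫ φ.i) (coprod.inr ≫ φ.i) = φ.i :=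
    coprod.hom_ext (coprod.inl_desc _ _) (coprod.inr_desc _ _)
  let j : Interval V :=
    { J := φ.Z, d := coprod.inl ≫ φ.i, c := coprod.inr ≫ φ.i, e := φ.p ≫ e
      d_e := by rw [Category.assoc, reassoc_of% hinl, hd]
      c_e := by rw [Category.assoc, reassoc_of% hinr, hc]
      cofibration := by rw [hi]; exact (cofibration_iff _).2 φ.hi
      weakEquivalence := inferInstance }
  exact ⟨j, φ.p, (Category.assoc _ _ _).trans hinl, (Category.assoc _ _ _).trans hinr, rfl⟩

lemma Interval.d_mem_trivialCofibrations (hI : IsCofibrant (𝟙_ V)) (j : Interval V) :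
    trivialCofibrations V j.d := by
  have := j.cofibration
  have := j.weakEquivalence
  have hd : coprod.inl ≫ coprod.desc j.d j.c = j.d := coprod.inl_desc _ _
  have : Cofibration j.d := by rw [← hd]; infer_instance
  have : WeakEquivalence (𝟙 (𝟙_ V)) := inferInstance
  have : WeakEquivalence j.d := weakEquivalence_of_postcomp_of_fac j.d_e
  exact mem_trivialCofibrations _

lemma Interval.exists_glue (hI : IsCofibrant (𝟙_ V)) (j j' : Interval V) :
    ∃ (i : Interval V) (p : i.J ⟶ pushout j.c j'.d), i.d ≫ p = j.d ≫ pushout.inl _ _ ∧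
      i.c ≫ p = j'.c ≫ pushout.inr _ _ ∧
      p ≫ pushout.desc j.e j'.e (j.c_e.trans j'.d_e.symm) = i.e := by
  have := j.weakEquivalence
  have hinl : trivialCofibrations V (pushout.inl j.c j'.d) :=
    MorphismProperty.of_isPushout (IsPushout.of_hasPushout j.c j'.d)
      (j'.d_mem_trivialCofibrations hI)
  have : WeakEquivalence (pushout.inl j.c j'.d) := ((mem_trivialCofibrations_iff _).1 hinl).2
  have : WeakEquivalence (pushout.desc j.e j'.e (j.c_e.trans j'.d_e.symm)) :=
    weakEquivalence_of_precomp_of_fac (pushout.inl_desc _ _ _)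
  exact exists_interval _ _ _ (by rw [Category.assoc, pushout.inl_desc, j.d_e])
    (by rw [Category.assoc, pushout.inr_desc, j'.c_e])

/-- Two points of `X` are homotopic over `π : X ⟶ Y` if an interval connects them whose image
in `Y` is constant. -/
def HomotopicOver {X Y : V} (π : X ⟶ Y) (a b : 𝟙_ V ⟶ X) : Prop :=
  ∃ (j : Interval V) (h : j.J ⟶ X), j.d ≫ h = a ∧ j.c ≫ h = b ∧
    ∃ k : 𝟙_ V ⟶ Y, h ≫ π = j.e ≫ k

lemma HomotopicOver.map {X Y X' Y' : V} {π : X ⟶ Y} {π' : X' ⟶ Y'} {a b : 𝟙_ V ⟶ X}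
    (h : HomotopicOver π a b) (m : X ⟶ X') (n : Y ⟶ Y') (e : m ≫ π' = π ≫ n) :
    HomotopicOver π' (a ≫ m) (b ≫ m) := by
  obtain ⟨j, h, rfl, rfl, k, hk⟩ := h
  exact ⟨j, h ≫ m, by simp, by simp, k ≫ n, by rw [Category.assoc, e, reassoc_of% hk]⟩

lemma HomotopicOver.trans (hI : IsCofibrant (𝟙_ V)) {X Y : V} {π : X ⟶ Y} {a b c : 𝟙_ V ⟶ X}
    (h : HomotopicOver π a b) (h' : HomotopicOver π b c) : HomotopicOver π a c := by
  obtain ⟨j, f, rfl, hb, k, hk⟩ := h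
  obtain ⟨j', f', hb', rfl, k', hk'⟩ := h'
  obtain rfl : k = k' := by
    have hc := j.c ≫= hk
    have hd := j'.d ≫= hk'
    rw [reassoc_of% hb, reassoc_of% j.c_e] at hc
    rw [reassoc_of% hb', reassoc_of% j'.d_e] at hd
    exact hc.symm.trans hd
  obtain ⟨i, p, hd, hc, he⟩ := Interval.exists_glue hI j j'
  let g : pushout j.c j'.d ⟶ X := pushout.desc f f' (hb.trans hb'.symm)
  have hg : g ≫ π = pushout.desc j.e j'.e (j.c_e.trans j'.d_e.symm) ≫ k := by
    apply pushout.hom_ext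
    · rw [pushout.inl_desc_assoc, pushout.inl_desc_assoc, hk]
    · rw [pushout.inr_desc_assoc, pushout.inr_desc_assoc, hk']
  refine ⟨i, p ≫ g, ?_, ?_, k, ?_⟩
  · rw [reassoc_of% hd, pushout.inl_desc]
  · rw [reassoc_of% hc, pushout.inr_desc]
  · rw [Category.assoc, hg, reassoc_of% he]

lemma HomotopicOver.of_trivialFibration {X Y : V} {π : X ⟶ Y} (hπ : trivialFibrations V π)
    {a b : 𝟙_ V ⟶ X} (e : a ≫ π = b ≫ π) : HomotopicOver π a b := by
  obtain ⟨_, _⟩ := (mem_trivialFibrations_iff _).1 hπ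
  obtain ⟨j, -⟩ := exists_interval (𝟙 (𝟙_ V)) (𝟙 _) (𝟙 _) (by simp) (by simp)
  have := j.cofibration
  have sq : CommSq (coprod.desc a b) (coprod.desc j.d j.c) π (j.e ≫ a ≫ π) := ⟨by
    ext
    · rw [coprod.inl_desc_assoc, coprod.inl_desc_assoc, reassoc_of% j.d_e]
    · rw [coprod.inr_desc_assoc, coprod.inr_desc_assoc, reassoc_of% j.c_e, e]⟩
  refine ⟨j, sq.lift, ?_, ?_, a ≫ π, sq.fac_right⟩
  · rw [← coprod.inl_desc_assoc j.d j.c, sq.fac_left, coprod.inl_desc]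
  · rw [← coprod.inr_desc_assoc j.d j.c, sq.fac_left, coprod.inr_desc]

omit [MonoidalCategory V] in
lemma exists_section_of_trivialFibration {A : V} (hA : IsCofibrant A) {X : V} {p : X ⟶ A}
    (hp : trivialFibrations V p) : ∃ q : A ⟶ X, q ≫ p = 𝟙 _ := by
  obtain ⟨_, _⟩ := (mem_trivialFibrations_iff _).1 hp
  have sq : CommSq (initial.to X) (initial.to A) p (𝟙 _) := ⟨Subsingleton.elim _ _⟩
  exact ⟨sq.lift, sq.fac_right⟩

end Homotopy

section Elements

variable [MonoidalClosed V] {C : Type u'} [EnrichedCategory V C]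

/-- An element of a `V`-functor `F`: an object of `C` with a point of the value of `F` there. -/
structure Element (F : EnrichedFunctor V C V) where
  obj : C
  point : 𝟙_ V ⟶ F.obj obj

variable {F : EnrichedFunctor V C V}

namespace Element

variable [HasPullbacks V] (a b c : Element F)

/-- The object of morphisms of elements: the part of `C(a,b)` sending the point of `a` to that
of `b`. -/
def hom : V := pullback (evalMap F a.point b.obj) b.point

/-- The underlying morphism in `C` of a morphism of elements. -/
def fst : hom a b ⟶ EnrichedCategory.Hom a.obj b.obj := pullback.fst _ _

/-- The augmentation of the object of morphisms of elements. -/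
def snd : hom a b ⟶ 𝟙_ V := pullback.snd _ _

lemma evalAt_fst : evalAt F a.point (fst a b) = snd a b ≫ b.point := by
  rw [← comp_evalMap]
  exact pullback.condition

variable {a b}

/-- The generalized element of `hom a b` given by its two components. -/
def lift {Y : V} (g : Y ⟶ EnrichedCategory.Hom a.obj b.obj) (t : Y ⟶ 𝟙_ V)
    (h : evalAt F a.point g = t ≫ b.point) : Y ⟶ hom a b :=
  pullback.lift g t (by rw [comp_evalMap, h])

@[simp]
lemma lift_fst {Y : V} (g : Y ⟶ EnrichedCategory.Hom a.obj b.obj) (t : Y ⟶ 𝟙_ V)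
    (h : evalAt F a.point g = t ≫ b.point) : lift g t h ≫ fst a b = g :=
  pullback.lift_fst _ _ _

@[simp]
lemma lift_snd {Y : V} (g : Y ⟶ EnrichedCategory.Hom a.obj b.obj) (t : Y ⟶ 𝟙_ V)
    (h : evalAt F a.point g = t ≫ b.point) : lift g t h ≫ snd a b = t :=
  pullback.lift_snd _ _ _

lemma hom_ext {Y : V} {f g : Y ⟶ hom a b} (h₁ : f ≫ fst a b = g ≫ fst a b)
    (h₂ : f ≫ snd a b = g ≫ snd a b) : f = g :=
  pullback.hom_ext h₁ h₂

variable (a b)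

/-- The identity of an element. -/
def id : 𝟙_ V ⟶ hom a a :=
  lift (eId V a.obj) (𝟙 _) (by rw [evalAt_eId, Category.id_comp])

lemma id_fst : id a ≫ fst a a = eId V a.obj := lift_fst _ _ _

lemma id_snd : id a ≫ snd a a = 𝟙 _ := lift_snd _ _ _

variable [SymmetricCategory V]

/-- Composition of morphisms of elements. -/
def comp : hom a b ⊗ hom b c ⟶ hom a c :=
  lift (hcomp (fst a b) (fst b c)) ((snd a b ⊗ₘ snd b c) ≫ (λ_ _).hom)
    (by rw [evalAt_hcomp_of_eq F (evalAt_fst a b) (evalAt_fst b c), Category.assoc])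

lemma comp_fst : comp a b c ≫ fst a c = hcomp (fst a b) (fst b c) := lift_fst _ _ _

lemma comp_snd : comp a b c ≫ snd a c = (snd a b ⊗ₘ snd b c) ≫ (λ_ _).hom := lift_snd _ _ _

end Element

/-- The full sub-`V`-category of the `V`-category of elements of `F` on a family of elements. -/
structure Elements {ι : Type w} (x : ι → Element F) : Type w where
  index : ι

namespace Elements

variable [HasPullbacks V] [SymmetricCategory V] {ι : Type w} (x : ι → Element F)

open Element in
instance : EnrichedCategory V (Elements x) where
  Hom i j := hom (x i.index) (x j.index)
  id i := Element.id (x i.index)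
  comp i j k := comp (x i.index) (x j.index) (x k.index)
  id_comp i j := by
    apply hom_ext
    · rw [Category.assoc, Category.assoc, comp_fst, ← hcomp_comp_left, id_fst, eId_hcomp]
      simp
    · rw [Category.assoc, Category.assoc, comp_snd, ← MonoidalCategory.tensorHom_id,
        MonoidalCategory.tensorHom_comp_tensorHom_assoc, id_snd, MonoidalCategory.id_tensorHom]
      simp
  comp_id i j := by
    apply hom_ext
    · rw [Category.assoc, Category.assoc, comp_fst, ← hcomp_comp_right, id_fst, hcomp_eId]
      simp
    · rw [Category.assoc, Category.assoc, comp_snd, ← MonoidalCategory.id_tensorHom,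
        MonoidalCategory.tensorHom_comp_tensorHom_assoc, id_snd, MonoidalCategory.tensorHom_id,
        unitors_equal]
      simp
  assoc i j k l := by
    apply hom_ext
    · rw [Category.assoc, Category.assoc, Category.assoc, comp_fst, comp_fst, ← hcomp_comp_left,
        ← hcomp_comp_right, comp_fst, comp_fst, hcomp_assoc, Iso.inv_hom_id_assoc]
    · rw [Category.assoc, Category.assoc, Category.assoc, comp_snd, comp_snd,
        ← MonoidalCategory.tensorHom_id, MonoidalCategory.tensorHom_comp_tensorHom_assoc,
        comp_snd, ← MonoidalCategory.id_tensorHom,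
        MonoidalCategory.tensorHom_comp_tensorHom_assoc, comp_snd, Category.id_comp,
        Category.id_comp, ← MonoidalCategory.tensorHom_comp_whiskerRight,
        ← MonoidalCategory.tensorHom_comp_whiskerLeft, Category.assoc, Category.assoc,
        ← MonoidalCategory.associator_inv_naturality_assoc]
      congr 1
      monoidal

/-- The forgetful `V`-functor from elements to `C`. -/
@[reducible]
def forget : EnrichedFunctor V (Elements x) C where
  obj i := (x i.index).obj
  map i j := Element.fst (x i.index) (x j.index)
  map_id i := Element.id_fst (x i.index)
  map_comp i j k := Element.comp_fst (x i.index) (x j.index) (x k.index)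

/-- The augmentation `V`-functor from elements to the unit `V`-category. -/
def toUnit : EnrichedFunctor V (Elements x) (UnitCat V) where
  obj _ := ()
  map i j := Element.snd (x i.index) (x j.index)
  map_id i := Element.id_snd (x i.index)
  map_comp i j k := Element.comp_snd (x i.index) (x j.index) (x k.index)

/-- The constant weight `𝟙_ V` on elements, as the composite occurring in
`HasEnoughCofibrantlyWeightedLimits`. -/
abbrev unitWeight : EnrichedFunctor V (Elements x) V := (toUnit x).comp V (EWeak.unitWeight V)

lemma act_unitWeight (i j : Elements x) : act (unitWeight x) i j =
    _ ◁ Element.snd (x i.index) (x j.index) ≫ (λ_ (𝟙_ V)).hom := by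
  have hunit : act (EWeak.unitWeight V) () () = (λ_ (𝟙_ V)).hom := by
    rw [unitors_equal]
    exact (congrArg MonoidalClosed.uncurry (MonoidalClosed.id_eq (𝟙_ V))).trans
      (MonoidalClosed.uncurry_curry _)
  exact (act_comp_functor (toUnit x) (EWeak.unitWeight V) i j).trans
    (congrArg (fun f => 𝟙_ V ◁ Element.snd (x i.index) (x j.index) ≫ f) hunit)

end Elements

end Elements

section ElementsLimit

variable [SymmetricCategory V] [MonoidalClosed V] [HasLimits V] [ModelCategory V]
  {C : Type u'} [EnrichedCategory V C] {F : EnrichedFunctor V C V} {ι : Type v}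

/-- The limit of a small family of elements of `F`, weighted by a cofibrant replacement of the
constant weight `𝟙_ V` and preserved by `F`. -/
structure ElementsLimit (x : ι → Element F) where
  Q : EnrichedFunctor V (Elements x) V
  p : WeightHom Q (Elements.unitWeight x)
  cofibrant : IsCofibrantWeight Q
  trivialFibration : IsPointwiseTrivialFibration p
  L : C
  η : WeightHom Q (homFrom (Elements.forget x) L)
  isLimit : IsLimitCone η
  isLimiting : IsLimiting F η

lemma ElementsLimit.nonempty (hC : HasEnoughCofibrantlyWeightedLimits V C)
    (hF : ∀ {D : Type v} [EnrichedCategory V D] {Q : EnrichedFunctor V D V}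
      {S : EnrichedFunctor V D C} {L : C} {η : WeightHom Q (homFrom S L)},
      IsLimitCone η → IsLimiting F η) (x : ι → Element F) : Nonempty (ElementsLimit x) := by
  obtain ⟨Q, p, hQ, hp, hS⟩ := hC (Elements x) (Elements.toUnit x)
  obtain ⟨L, η, hη⟩ := hS (Elements.forget x)
  have hL := isLimitCone_of_isIso_limitMap η hη
  exact ⟨⟨Q, p, hQ, hp, L, η, hL, hF hL⟩⟩

namespace ElementsLimit

variable {x : ι → Element F} (l : ElementsLimit x)

/-- The augmentation of the weight. -/
def aug (i : Elements x) : l.Q.obj i ⟶ 𝟙_ V := l.p.app i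

/-- The projections of the limit. -/
def π (i : Elements x) : l.Q.obj i ⟶ EnrichedCategory.Hom l.L (x i.index).obj := coneApp l.η i

lemma act_aug (i j : Elements x) : act l.Q i j ≫ l.aug j =
    (l.aug i ⊗ₘ Element.snd (x i.index) (x j.index)) ≫ (λ_ _).hom := by
  have h : act l.Q i j ≫ l.aug j = l.aug i ▷ _ ≫ act (Elements.unitWeight x) i j :=
    l.p.act_comp i j
  rw [MonoidalCategory.tensorHom_def, Category.assoc]
  exact h.trans (congrArg (fun f => l.aug i ▷ _ ≫ f) (Elements.act_unitWeight x i j))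

lemma act_π (i j : Elements x) :
    act l.Q i j ≫ l.π j = hcomp (l.π i) (Element.fst (x i.index) (x j.index)) :=
  act_coneApp l.η i j

lemma exists_actOn_π_eq {Z : V} {t : ∀ i, Z ⊗ l.Q.obj i ⟶ 𝟙_ V}
    (ht : IsNatFamily l.Q (Elements.unitWeight x) t) :
    ∃ g : Z ⟶ F.obj l.L, ∀ i, actOn F g (l.π i) = t i ≫ (x i.index).point := by
  refine (l.isLimiting (fun i => t i ≫ (x i.index).point) fun i j => ?_).exists
  have h : t i ▷ Element.hom (x i.index) (x j.index) ≫
      𝟙_ V ◁ Element.snd (x i.index) (x j.index) ≫ (λ_ (𝟙_ V)).hom =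
      (α_ _ _ _).hom ≫ Z ◁ act l.Q i j ≫ t j :=
    (congrArg (fun f => t i ▷ _ ≫ f) (Elements.act_unitWeight x i j)).symm.trans (ht i j)
  rw [actOn_comp_left, actOn_unit, Element.evalAt_fst, ← leftUnitor_naturality_assoc]
  have hx := congrArg (fun f => f ≫ (x j.index).point) h
  simp only [Category.assoc] at hx
  exact hx

lemma exists_point :
    ∃ ξ : 𝟙_ V ⟶ F.obj l.L, ∀ i, evalAt F ξ (l.π i) = l.aug i ≫ (x i.index).point := by
  obtain ⟨ξ, hξ⟩ := l.exists_actOn_π_eq l.p.isNatFamily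
  refine ⟨ξ, fun i => (congrArg (fun f => (λ_ _).inv ≫ f) (hξ i)).trans ?_⟩
  have h : (λ_ _).inv ≫ ((λ_ _).hom ≫ l.aug i) ≫ (x i.index).point =
      l.aug i ≫ (x i.index).point := by
    rw [Category.assoc, Iso.inv_hom_id_assoc]
  exact h

/-- The canonical point of the value of `F` at the limit. -/
def point : 𝟙_ V ⟶ F.obj l.L := l.exists_point.choose

/-- The limit, as an element of `F`. -/
abbrev element : Element F := ⟨l.L, l.point⟩

lemma evalAt_π (i : Elements x) :
    evalAt F l.point (l.π i) = l.aug i ≫ (x i.index).point :=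
  l.exists_point.choose_spec i

lemma evalAt_comp_π {i : Elements x} {q : 𝟙_ V ⟶ l.Q.obj i} (hq : q ≫ l.aug i = 𝟙 _) :
    evalAt F l.point (q ≫ l.π i) = (x i.index).point := by
  rw [evalAt_comp, evalAt_π, reassoc_of% hq]

lemma exists_comp_aug_eq_id (hI : IsCofibrant (𝟙_ V)) (i : Elements x) :
    ∃ q : 𝟙_ V ⟶ l.Q.obj i, q ≫ l.aug i = 𝟙 _ :=
  exists_section_of_trivialFibration hI (l.trivialFibration i)

end ElementsLimit

end ElementsLimit

section ElementsLimitEndo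

variable [SymmetricCategory V] [MonoidalClosed V] [HasLimits V] [ModelCategory V]
  {C : Type u'} [EnrichedCategory V C] {F : EnrichedFunctor V C V} {ι : Type v}
  {x : ι → Element F} (l : ElementsLimit x)

namespace ElementsLimit

section WeightEndo

variable {i : Elements x}

lemma evalAt_weight_aug {j : Elements x} {q : 𝟙_ V ⟶ l.Q.obj i} (hq : q ≫ l.aug i = 𝟙 _)
    {Y : V} (g : Y ⟶ Element.hom (x i.index) (x j.index)) :
    evalAt l.Q q g ≫ l.aug j = g ≫ Element.snd (x i.index) (x j.index) := by
  have h : evalAt l.Q q g = (λ_ _).inv ≫ (q ⊗ₘ g) ≫ act l.Q i j := rfl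
  rw [h, Category.assoc, Category.assoc, act_aug, ← Category.assoc (q ⊗ₘ g),
    MonoidalCategory.tensorHom_comp_tensorHom, hq, MonoidalCategory.id_tensorHom,
    leftUnitor_naturality, Iso.inv_hom_id_assoc]

lemma evalAt_weight_π {j : Elements x} (q : 𝟙_ V ⟶ l.Q.obj i) {Y : V}
    (g : Y ⟶ Element.hom (x i.index) (x j.index)) :
    evalAt l.Q q g ≫ l.π j =
      (g ≫ Element.fst (x i.index) (x j.index)) ≫ preComp (q ≫ l.π i) _ := by
  have h : evalAt l.Q q g = (λ_ _).inv ≫ (q ⊗ₘ g) ≫ act l.Q i j := rfl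
  rw [h, Category.assoc, Category.assoc, act_π, ← hcomp_comp, comp_preComp]

variable (g : 𝟙_ V ⟶ EnrichedCategory.Hom (x i.index).obj l.L)
  (hg : evalAt F (x i.index).point g = l.point)

/-- The projections of the limit restricted along `g : x i ⟶ L`, as morphisms of elements. -/
def projAlong (j : Elements x) : l.Q.obj j ⟶ Element.hom (x i.index) (x j.index) :=
  Element.lift (l.π j ≫ preComp g _) (l.aug j) (by rw [evalAt_preComp, hg, evalAt_π])

lemma act_projAlong (j k : Elements x) : act l.Q j k ≫ l.projAlong g hg k =
    hcomp (C := Elements x) (l.projAlong g hg j) (𝟙 (EnrichedCategory.Hom j k)) := by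
  have h : hcomp (C := Elements x) (l.projAlong g hg j) (𝟙 (EnrichedCategory.Hom j k)) =
    (l.projAlong g hg j ⊗ₘ 𝟙 (Element.hom (x j.index) (x k.index))) ≫
      Element.comp (x i.index) (x j.index) (x k.index) := rfl
  rw [h]
  apply Element.hom_ext
  · rw [Category.assoc, Category.assoc, Element.comp_fst, ← hcomp_comp, projAlong, projAlong,
      Element.lift_fst, Element.lift_fst, Category.id_comp, reassoc_of% l.act_π j k, hcomp_preComp]
  · rw [Category.assoc, Category.assoc, Element.comp_snd, ← Category.assoc (_ ⊗ₘ _),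
      MonoidalCategory.tensorHom_comp_tensorHom, projAlong, projAlong, Element.lift_snd,
      Element.lift_snd, Category.id_comp, act_aug]

/-- The endomorphism of the weight induced by a point `q` of `Q i` and `g : x i ⟶ L`; on the limit
it induces the endomorphism `L ⟶ x i ⟶ L`. -/
def weightEndo (q : 𝟙_ V ⟶ l.Q.obj i) : WeightHom l.Q l.Q :=
  WeightHom.ofAct (fun j => evalAt l.Q q (l.projAlong g hg j)) fun j k => by
    have h : evalAt l.Q q (l.projAlong g hg j) ▷ _ ≫ act l.Q j k =
        actOn l.Q (evalAt l.Q q (l.projAlong g hg j)) (𝟙 (EnrichedCategory.Hom j k)) := by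
      rw [actOn, MonoidalCategory.tensorHom_id]
    rw [h, ← evalAt_hcomp, ← act_projAlong]
    exact (evalAt_comp l.Q q _ _).symm

lemma weightEndo_aug {q : 𝟙_ V ⟶ l.Q.obj i} (hq : q ≫ l.aug i = 𝟙 _) (j : Elements x) :
    (l.weightEndo g hg q).app j ≫ l.aug j = l.aug j :=
  (l.evalAt_weight_aug hq _).trans (Element.lift_snd _ _ _)

lemma weightEndo_π (q : 𝟙_ V ⟶ l.Q.obj i) (j : Elements x) :
    (l.weightEndo g hg q).app j ≫ l.π j = l.π j ≫ preComp (g ≫ preComp (q ≫ l.π i) _) _ := by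
  refine (l.evalAt_weight_π q _).trans ?_
  rw [projAlong, Element.lift_fst, Category.assoc, preComp_preComp]

end WeightEndo

lemma exists_natObj_square :
    ∃ (m : natObj l.Q l.Q ⟶ EnrichedCategory.Hom l.L l.L)
      (n : natObj l.Q (Elements.unitWeight x) ⟶ F.obj l.L),
      (∀ {Z : V} (f : Z ⟶ natObj l.Q l.Q) (i : Elements x),
        hcomp (f ≫ m) (l.π i) = natFamily l.Q l.Q f i ≫ l.π i) ∧
      m ≫ evalMap F l.point l.L = natObjMap l.Q l.p ≫ n := by
  obtain ⟨m, hm, -⟩ := l.isLimit (fun i => natFamily l.Q l.Q (𝟙 _) i ≫ l.π i) fun i j => by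
    rw [hcomp_comp_left, ← reassoc_of% isNatFamily_natFamily (𝟙 (natObj l.Q l.Q)) i j]
    exact congrArg _ (l.act_π i j).symm
  have hm' : ∀ i, hcomp m (l.π i) = natFamily l.Q l.Q (𝟙 _) i ≫ l.π i := hm
  obtain ⟨n, hn⟩ := l.exists_actOn_π_eq
    (isNatFamily_natFamily (𝟙 (natObj l.Q (Elements.unitWeight x))))
  refine ⟨m, n, fun f i => ?_, l.isLimiting.hom_ext fun i => ?_⟩
  · rw [hcomp_comp_left, hm', ← Category.assoc, ← natFamily_comp, Category.comp_id]
  · have h := natFamily_natObjMap l.p (𝟙 (natObj l.Q l.Q)) i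
    rw [Category.id_comp, ← Category.comp_id (natObjMap l.Q l.p), natFamily_comp] at h
    have hleft : actOn F (m ≫ evalMap F l.point l.L) (l.π i) =
        natFamily l.Q l.Q (𝟙 _) i ≫ l.aug i ≫ (x i.index).point := by
      rw [comp_evalMap, ← evalAt_hcomp, hm', evalAt_comp, evalAt_π]
    have hright : actOn F (natObjMap l.Q l.p ≫ n) (l.π i) = natObjMap l.Q l.p ▷ _ ≫
        natFamily l.Q (Elements.unitWeight x) (𝟙 _) i ≫ (x i.index).point := by
      rw [actOn_comp_left, hn]
      rfl
    exact hleft.trans (((Category.assoc _ _ _).symm.trans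
      ((congrArg (fun f => f ≫ (x i.index).point) h).symm.trans (Category.assoc _ _ _))).trans
        hright.symm)

/-- The comparison `[D,V](Q,Q) ⟶ [D,V](Q,I)` is a trivial fibration because `Q` is cofibrant. -/
lemma homotopicOver_of_weightHom {φ ψ : WeightHom l.Q l.Q}
    (hφψ : ∀ j, φ.app j ≫ l.aug j = ψ.app j ≫ l.aug j)
    {a b : 𝟙_ V ⟶ EnrichedCategory.Hom l.L l.L}
    (ha : ∀ j, hcomp a (l.π j) = (λ_ _).hom ≫ φ.app j ≫ l.π j)
    (hb : ∀ j, hcomp b (l.π j) = (λ_ _).hom ≫ ψ.app j ≫ l.π j) :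
    HomotopicOver (evalMap F l.point l.L) a b := by
  obtain ⟨f, hf⟩ := exists_natFamily_eq φ.isNatFamily
  obtain ⟨g, hg⟩ := exists_natFamily_eq ψ.isNatFamily
  obtain ⟨m, n, hm, hsq⟩ := l.exists_natObj_square
  have hfg : f ≫ natObjMap l.Q l.p = g ≫ natObjMap l.Q l.p := natFamily_ext fun i => by
    rw [natFamily_natObjMap, natFamily_natObjMap, hf, hg, Category.assoc, Category.assoc]
    exact congrArg (fun t => (λ_ _).hom ≫ t) (hφψ i)
  have hfa : f ≫ m = a := l.isLimit.hom_ext fun i => (hm f i).trans <| by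
    rw [hf, Category.assoc]
    exact (ha i).symm
  have hgb : g ≫ m = b := l.isLimit.hom_ext fun i => (hm g i).trans <| by
    rw [hg, Category.assoc]
    exact (hb i).symm
  rw [← hfa, ← hgb]
  exact (HomotopicOver.of_trivialFibration (l.cofibrant _ _ l.p l.trivialFibration) hfg).map m n hsq

lemma homotopicOver_endo {i : Elements x} {g : 𝟙_ V ⟶ EnrichedCategory.Hom (x i.index).obj l.L}
    (hg : evalAt F (x i.index).point g = l.point) {q : 𝟙_ V ⟶ l.Q.obj i}
    (hq : q ≫ l.aug i = 𝟙 _) :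
    HomotopicOver (evalMap F l.point l.L) (eId V l.L) (g ≫ preComp (q ≫ l.π i) _) ∧
      HomotopicOver (evalMap F l.point l.L) (g ≫ preComp (q ≫ l.π i) _) (eId V l.L) := by
  let one : WeightHom l.Q l.Q := WeightHom.ofAct (fun j => 𝟙 _) (by simp)
  have haug : ∀ j, one.app j ≫ l.aug j = (l.weightEndo g hg q).app j ≫ l.aug j := fun j =>
    (Category.id_comp _).trans (l.weightEndo_aug g hg hq j).symm
  have hone : ∀ j, hcomp (eId V l.L) (l.π j) = (λ_ _).hom ≫ one.app j ≫ l.π j := fun j => by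
    rw [eId_hcomp]
    exact congrArg _ (Category.id_comp _).symm
  have hendo : ∀ j, hcomp (g ≫ preComp (q ≫ l.π i) _) (l.π j) =
      (λ_ _).hom ≫ (l.weightEndo g hg q).app j ≫ l.π j := fun j => by
    rw [weightEndo_π, hcomp_point]
  exact ⟨l.homotopicOver_of_weightHom haug hone hendo,
    l.homotopicOver_of_weightHom (fun j => (haug j).symm) hendo hone⟩

end ElementsLimit

end ElementsLimitEndo

section HomotopyInitial

variable [SymmetricCategory V] [MonoidalClosed V] {C : Type u'} [EnrichedCategory V C]
  {F : EnrichedFunctor V C V}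

/-- Every element of `F` is the image of a member of the family `x` under a morphism of `C`. -/
def IsWeaklyInitial {ι : Type w} (x : ι → Element F) : Prop :=
  ∀ y : Element F, ∃ (i : ι) (u : 𝟙_ V ⟶ EnrichedCategory.Hom (x i).obj y.obj),
    evalAt F (x i).point u = y.point

variable [ModelCategory V]

/-- An element of `F` is homotopy initial if it maps to every element of `F`, and any two maps
to the same element are homotopic over it. -/
structure IsHomotopyInitial (ξ : Element F) : Prop where
  exists_map (y : Element F) :
    ∃ u : 𝟙_ V ⟶ EnrichedCategory.Hom ξ.obj y.obj, evalAt F ξ.point u = y.point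
  homotopic {B : C} (u v : 𝟙_ V ⟶ EnrichedCategory.Hom ξ.obj B)
    (h : evalAt F ξ.point u = evalAt F ξ.point v) : HomotopicOver (evalMap F ξ.point B) u v

variable [HasLimits V]

namespace ElementsLimit

variable {ι : Type v} {x : ι → Element F} (l : ElementsLimit x)

lemma exists_map_of_isWeaklyInitial (hI : IsCofibrant (𝟙_ V)) (hx : IsWeaklyInitial x)
    (y : Element F) :
    ∃ u : 𝟙_ V ⟶ EnrichedCategory.Hom l.L y.obj, evalAt F l.point u = y.point := by
  obtain ⟨i, u, hu⟩ := hx y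
  obtain ⟨q, hq⟩ := l.exists_comp_aug_eq_id hI ⟨i⟩
  exact ⟨u ≫ preComp (q ≫ l.π ⟨i⟩) _, by rw [evalAt_preComp, l.evalAt_comp_π hq, hu]⟩

lemma homotopicOver_preComp {i j : Elements x} {q : 𝟙_ V ⟶ l.Q.obj i} (hq : q ≫ l.aug i = 𝟙 _)
    {u v : 𝟙_ V ⟶ EnrichedCategory.Hom (x i.index).obj (x j.index).obj}
    (hu : evalAt F (x i.index).point u = (x j.index).point)
    (hv : evalAt F (x i.index).point v = (x j.index).point) :
    HomotopicOver (evalMap F l.point _) (u ≫ preComp (q ≫ l.π i) _)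
      (v ≫ preComp (q ≫ l.π i) _) := by
  let u' : 𝟙_ V ⟶ Element.hom (x i.index) (x j.index) :=
    Element.lift u (𝟙 _) (hu.trans (Category.id_comp _).symm)
  let v' : 𝟙_ V ⟶ Element.hom (x i.index) (x j.index) :=
    Element.lift v (𝟙 _) (hv.trans (Category.id_comp _).symm)
  have haug : evalAt l.Q q u' ≫ l.aug j = evalAt l.Q q v' ≫ l.aug j := by
    rw [l.evalAt_weight_aug hq, l.evalAt_weight_aug hq, Element.lift_snd, Element.lift_snd]
  have h := (HomotopicOver.of_trivialFibration (l.trivialFibration j) haug).map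
    (π' := evalMap F l.point _) (l.π j) (x j.index).point
    ((comp_evalMap F l.point (l.π j)).trans (l.evalAt_π j))
  rwa [l.evalAt_weight_π, l.evalAt_weight_π, Element.lift_fst, Element.lift_fst] at h

end ElementsLimit

lemma exists_weak_equalizer (hI : IsCofibrant (𝟙_ V))
    (hlim : ∀ {ι : Type v} (x : ι → Element F), Nonempty (ElementsLimit x)) (ξ : Element F) {B : C}
    {u v : 𝟙_ V ⟶ EnrichedCategory.Hom ξ.obj B} (h : evalAt F ξ.point u = evalAt F ξ.point v) :
    ∃ (ζ : Element F) (e : 𝟙_ V ⟶ EnrichedCategory.Hom ζ.obj ξ.obj),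
      evalAt F ζ.point e = ξ.point ∧
        HomotopicOver (evalMap F ζ.point B) (u ≫ preComp e B) (v ≫ preComp e B) := by
  let y : Element F := ⟨B, evalAt F ξ.point u⟩
  let x : ULift.{v} Bool → Element F := fun b => cond b.down ξ y
  obtain ⟨l⟩ := hlim x
  obtain ⟨q, hq⟩ := l.exists_comp_aug_eq_id hI ⟨⟨true⟩⟩
  exact ⟨l.element, q ≫ l.π ⟨⟨true⟩⟩, l.evalAt_comp_π hq,
    l.homotopicOver_preComp (i := ⟨⟨true⟩⟩) (j := ⟨⟨false⟩⟩) hq rfl h.symm⟩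

/-- Weak initiality of `x` sends the weak equalizer `ζ` of `u` and `v` to an endomorphism of `L`
through `x i`, which is homotopic to the identity and equalizes `u` and `v` up to homotopy. -/
lemma ElementsLimit.isHomotopyInitial (hI : IsCofibrant (𝟙_ V))
    (hlim : ∀ {ι : Type v} (x : ι → Element F), Nonempty (ElementsLimit x))
    {ι : Type v} {x : ι → Element F} (hx : IsWeaklyInitial x) (l : ElementsLimit x) :
    IsHomotopyInitial l.element where
  exists_map := l.exists_map_of_isWeaklyInitial hI hx
  homotopic {B} u v huv := by
    obtain ⟨ζ, e, he, hζ⟩ := exists_weak_equalizer hI hlim l.element huv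
    obtain ⟨i, k, hk⟩ := hx ζ
    obtain ⟨q, hq⟩ := l.exists_comp_aug_eq_id hI ⟨i⟩
    let r := q ≫ l.π ⟨i⟩
    have hr : evalAt F l.point r = (x i).point := l.evalAt_comp_π hq
    have hg : evalAt F (x i).point (e ≫ preComp k _) = l.point := by rw [evalAt_preComp, hk, he]
    obtain ⟨hid, hid'⟩ := l.homotopicOver_endo (i := ⟨i⟩) hg hq
    have hwr : HomotopicOver (evalMap F l.point B) (((u ≫ preComp e B) ≫ preComp k B) ≫ preComp r B)
        (((v ≫ preComp e B) ≫ preComp k B) ≫ preComp r B) :=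
      (hζ.map (π' := evalMap F (x i).point B) (preComp k B) (𝟙 _)
        (by rw [preComp_evalMap, hk, Category.comp_id])).map (preComp r B) (𝟙 _)
        (by rw [preComp_evalMap, hr, Category.comp_id])
    have hw : ∀ w : 𝟙_ V ⟶ EnrichedCategory.Hom l.L B,
        ((e ≫ preComp k _) ≫ preComp r _) ≫ postComp w _ =
          ((w ≫ preComp e B) ≫ preComp k B) ≫ preComp r B := by
      intro w
      rw [point_postComp, preComp_preComp, preComp_preComp, Category.assoc, Category.assoc,
        Category.assoc]
    have hu := hid.map (postComp u l.L) _ (postComp_evalMap F l.point u)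
    have hv := hid'.map (postComp v l.L) _ (postComp_evalMap F l.point v)
    rw [eId_postComp, hw] at hu hv
    exact (hu.trans hI hwr).trans hI hv

end HomotopyInitial

section Shrinkable

variable [SymmetricCategory V] [MonoidalClosed V] {C : Type u'} [EnrichedCategory V C]

lemma uncurry_comp_powerMap {X Z : V} {A P B : C} (κ : X ⟶ EnrichedCategory.Hom P B)
    (g : Z ⟶ EnrichedCategory.Hom A P) :
    MonoidalClosed.uncurry (g ≫ powerMap κ A) = (β_ _ _).hom ≫ hcomp g κ := by
  rw [hcomp_eq_uncurry_powerMap, SymmetricCategory.symmetry_assoc]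

lemma comp_powerMap_eq_curry' {X : V} {A P B : C} {κ : X ⟶ EnrichedCategory.Hom P B}
    {g : 𝟙_ V ⟶ EnrichedCategory.Hom A P} {f : X ⟶ EnrichedCategory.Hom A B}
    (h : hcomp g κ = (λ_ _).hom ≫ f) : g ≫ powerMap κ A = MonoidalClosed.curry' f := by
  apply MonoidalClosed.uncurry_injective
  rw [uncurry_comp_powerMap, h, MonoidalClosed.curry', MonoidalClosed.uncurry_curry,
    braiding_tensorUnit_right, Category.assoc, Iso.inv_hom_id_assoc]

namespace IsHomotopyInitial

variable [ModelCategory V] {F : EnrichedFunctor V C V} {ξ : Element F}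

lemma exists_section (hξ : IsHomotopyInitial ξ) (hpow : HasPowers V C)
    (hF : ∀ {X : V} {P B : C} {κ : X ⟶ EnrichedCategory.Hom P B}, IsPower κ → IsPowering F κ)
    (A : C) : ∃ s : F.obj A ⟶ EnrichedCategory.Hom ξ.obj A, s ≫ evalMap F ξ.point A = 𝟙 _ := by
  obtain ⟨P, κ, hκ⟩ := hpow (F.obj A) A
  obtain ⟨z, hz, -⟩ := hF (isPower_of_isIso_powerMap κ hκ) (λ_ _).hom
  obtain ⟨u, hu⟩ := hξ.exists_map ⟨P, z⟩
  have hu' : evalAt F ξ.point u = z := hu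
  exact ⟨κ ≫ preComp u A, by
    rw [comp_evalMap, evalAt_preComp, hu', evalAt, hz, Iso.inv_hom_id]⟩

/-- Points `I ⟶ C(L,P)` of a power `P` of `A` by `C(L,A)` are endomorphisms of `C(L,A)`. -/
lemma shrinkable (hξ : IsHomotopyInitial ξ) (hpow : HasPowers V C)
    (hF : ∀ {X : V} {P B : C} {κ : X ⟶ EnrichedCategory.Hom P B}, IsPower κ → IsPowering F κ)
    (A : C) : Shrinkable (evalMap F ξ.point A) := by
  obtain ⟨s, hs⟩ := hξ.exists_section hpow hF A
  obtain ⟨P, κ, hκ⟩ := hpow (EnrichedCategory.Hom ξ.obj A) A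
  have hP := isPower_of_isIso_powerMap κ hκ
  obtain ⟨a, ha, -⟩ := hP ((λ_ _).hom ≫ evalMap F ξ.point A ≫ s)
  obtain ⟨b, hb, -⟩ := hP ((λ_ _).hom ≫ 𝟙 (EnrichedCategory.Hom ξ.obj A))
  have hab : evalAt F ξ.point a = evalAt F ξ.point b := by
    apply (hF hP ((λ_ _).hom ≫ evalMap F ξ.point A)).unique
    · rw [← evalAt_hcomp, ha, ← comp_evalMap, Category.assoc, Category.assoc, hs, Category.comp_id]
    · rw [← evalAt_hcomp, hb, ← comp_evalMap, Category.comp_id]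
  obtain ⟨j, h, hd, hc, k, hk⟩ := hξ.homotopic a b hab
  refine ⟨s, j, h ≫ powerMap κ ξ.obj, hs, ?_, ?_,
    MonoidalClosed.curry ((β_ _ _).hom ≫ actOn F k κ), ?_⟩
  · rw [reassoc_of% hd, comp_powerMap_eq_curry' ha]
  · rw [reassoc_of% hc, comp_powerMap_eq_curry' hb]
  · apply MonoidalClosed.uncurry_injective
    rw [MonoidalClosed.uncurry_natural_right, uncurry_comp_powerMap,
      MonoidalClosed.uncurry_natural_left, MonoidalClosed.uncurry_curry, Category.assoc,
      comp_evalMap, evalAt_hcomp, ← comp_evalMap, hk, actOn_comp_left,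
      BraidedCategory.braiding_naturality_right_assoc]

end IsHomotopyInitial

end Shrinkable

section WeakColimits

variable [SymmetricCategory V] [MonoidalClosed V] [HasLimits V] {C : Type u'}
  [EnrichedCategory V C]

section

variable {D : Type v} [EnrichedCategory V D] {W : EnrichedFunctor V Dᵒᵖ V}
  {S : EnrichedFunctor V D C}

lemma leftFamily_evalAt {A B : C} (y : 𝟙_ V ⟶ (natFunctor W S).obj A) {Y : V}
    (g : Y ⟶ EnrichedCategory.Hom A B) (X : Dᵒᵖ) :
    leftFamily (evalAt (natFunctor W S) y g) X = hcomp ((ρ_ _).inv ≫ leftFamily y X) g := by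
  rw [evalAt, leftFamily_comp, leftFamily_actOn, hcomp_comp_left,
    MonoidalCategory.triangle_assoc_comp_left_inv_assoc]

/-- The cocone corresponding to an element of `[Dᵒᵖ,V](W, C(S-,L))`. -/
def weightHomOfPoint {L : C} (ξ : 𝟙_ V ⟶ (natFunctor W S).obj L) : WeightHom W (homTo S L) :=
  WeightHom.ofAct (fun X => (ρ_ _).inv ≫ leftFamily ξ X) fun X Y => by
    have hleft : hcomp (S.map Y.unop X.unop) ((ρ_ _).inv ≫ leftFamily ξ X) =
        leftAct W X Y ≫ (ρ_ _).inv ≫ leftFamily ξ Y := by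
      rw [hcomp_comp_right, isLeftNatFamily_leftFamily ξ X Y, rightUnitor_inv_naturality_assoc,
        rightUnitor_tensor_inv, Category.assoc]
    have hright : ((ρ_ _).inv ≫ leftFamily ξ X) ▷ _ ≫ act (homTo S L) X Y =
        (β_ (W.obj X) (EnrichedCategory.Hom Y.unop X.unop)).hom ≫
          hcomp (S.map Y.unop X.unop) ((ρ_ _).inv ≫ leftFamily ξ X) := by
      rw [hcomp, MonoidalCategory.tensorHom_def', Category.assoc,
        ← BraidedCategory.braiding_naturality_left_assoc,
        ← BraidedCategory.braiding_naturality_right_assoc]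
      exact congrArg (fun f => ((ρ_ _).inv ≫ leftFamily ξ X) ▷ _ ≫ f) (act_homTo S L X Y)
    refine Eq.trans ?_ hright.symm
    rw [hleft, leftAct]
    refine Eq.symm ((congrArg _ (Category.assoc _ _ _)).trans ?_)
    exact SymmetricCategory.symmetry_assoc _ _ _

lemma colimitMap_weightHomOfPoint {L : C} (ξ : 𝟙_ V ⟶ (natFunctor W S).obj L) (A : C) :
    colimitMap (weightHomOfPoint ξ) A = evalMap (natFunctor W S) ξ A := by
  apply leftFamily_ext
  intro X
  have h : leftFamily (colimitMap (weightHomOfPoint ξ) A) X =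
      ((ρ_ _).inv ≫ leftFamily ξ X) ▷ _ ≫ eComp V (S.obj X.unop) L A :=
    (congrArg MonoidalClosed.uncurry (natObjLift_π W (homTo S A) _ _ X)).trans
      (MonoidalClosed.uncurry_curry _)
  rw [h, evalMap, leftFamily_evalAt, hcomp, MonoidalCategory.tensorHom_id]

end

/-- The solution set condition for `F`: it has a small weakly initial family of elements. -/
def HasSolutionSet (F : EnrichedFunctor V C V) : Prop :=
  ∃ (ι : Type v) (x : ι → Element F), IsWeaklyInitial x

theorem hasShrinkableWeakColimits_of_hasSolutionSet [ModelCategory V] (hI : IsCofibrant (𝟙_ V))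
    (hpow : HasPowers V C) (hlim : HasEnoughCofibrantlyWeightedLimits V C)
    (hsol : ∀ {D : Type v} [EnrichedCategory V D] (W : EnrichedFunctor V Dᵒᵖ V)
      (S : EnrichedFunctor V D C), HasSolutionSet (natFunctor W S)) :
    HasShrinkableWeakColimits V C := by
  intro D _ W S
  obtain ⟨ι, x, hx⟩ := hsol W S
  have hlim' : ∀ {ι : Type v} (x : ι → Element (natFunctor W S)), Nonempty (ElementsLimit x) :=
    ElementsLimit.nonempty hlim fun h => h.natFunctor W S
  obtain ⟨l⟩ := hlim' x
  refine ⟨l.L, weightHomOfPoint l.point, fun A => ?_⟩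
  rw [colimitMap_weightHomOfPoint]
  exact (l.isHomotopyInitial hI hlim' hx).shrinkable hpow (fun h => h.natFunctor W S) A

end WeakColimits

section StrongGenerator

lemma exists_factor_of_isStrongGenerator {E : Type u'} [Category.{v} E] [HasPullbacks E]
    {P : ObjectProperty E} (hP : P.IsStrongGenerator) {X Y Z : E} (m : X ⟶ Z) [Mono m] (x : Y ⟶ Z)
    (h : ∀ G, P G → ∀ t : G ⟶ Y, ∃ z : G ⟶ X, z ≫ m = t ≫ x) : ∃ z : Y ⟶ X, z ≫ m = x := by
  have : IsIso (pullback.snd m x) := hP.isIso_of_mono _ fun G hG t => by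
    obtain ⟨z, hz⟩ := h G hG t
    exact ⟨pullback.lift z t hz, pullback.lift_snd _ _ _⟩
  exact ⟨inv (pullback.snd m x) ≫ pullback.fst m x, by
    rw [Category.assoc, pullback.condition, IsIso.inv_hom_id_assoc]⟩

lemma exists_isStrongGenerator_ofObj (E : Type u') [Category.{v} E] {κ₀ κ : Cardinal.{w}}
    [Fact κ₀.IsRegular] [Fact κ.IsRegular] (hκ : κ₀ ≤ κ) [HasCardinalFilteredGenerator E κ₀] :
    ∃ (ω : Type w) (R : ω → E), (∀ a, IsCardinalPresentable (R a) κ) ∧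
      (ObjectProperty.ofObj R).IsStrongGenerator := by
  obtain ⟨P, _, hP⟩ := HasCardinalFilteredGenerator.exists_small_generator E κ₀
  let R (a : Shrink.{w} (Subtype P)) : E := ((equivShrink _).symm a).1
  have hR : ObjectProperty.ofObj R = P := by
    ext Y
    rw [ObjectProperty.ofObj_iff]
    refine ⟨?_, fun hY => ⟨equivShrink _ ⟨Y, hY⟩, by simp only [R, Equiv.symm_apply_apply]⟩⟩
    rintro ⟨a, rfl⟩
    exact ((equivShrink (Subtype P)).symm a).2
  refine ⟨_, R, fun a => ?_, by rw [hR]; exact hP.isStrongGenerator⟩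
  have : IsCardinalPresentable (R a) κ₀ :=
    hP.le_isCardinalPresentable _ ((equivShrink (Subtype P)).symm a).2
  exact isCardinalPresentable_of_le _ hκ

end StrongGenerator

section Trees

/-- Trees generated by leaves in `T` under unary operations in `Θ` and formation of families
indexed by subsets of `κ`. They index the `κ`-directed subsets of a preorder that are generated by
a family of elements under given operations, so that the size of such a subset is bounded
independently of the preorder. -/
inductive Tree (T Θ : Type v) (κ : Cardinal.{v}) : Type v
  | base (t : T) : Tree T Θ κ
  | step (θ : Θ) (m : Tree T Θ κ) : Tree T Θ κ
  | bound (s : Set κ.ord.ToType) (f : s → Tree T Θ κ) : Tree T Θ κ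

namespace Tree

variable {T Θ : Type v} {κ : Cardinal.{v}} {α : Type w} [Preorder α]

section

variable [Nonempty α]

open Classical in
/-- Interpretation of trees in a preorder, given the values of the leaves. An operation sends `x`
to some `y` satisfying a prescribed relation, and families are sent to an upper bound; where no
such value exists the interpretation is arbitrary. -/
def eval (b : T → α) (R : Θ → α → α → Prop) : Tree T Θ κ → α
  | base t => b t
  | step θ m => Classical.epsilon fun y => R θ (eval b R m) y
  | bound _ f => Classical.epsilon fun y => ∀ x, eval b R (f x) ≤ y

variable (b : T → α) {R : Θ → α → α → Prop}

lemma rel_eval_step {θ : Θ} {m : Tree T Θ κ} (h : ∃ y, R θ (eval b R m) y) :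
    R θ (eval b R m) (eval b R (step θ m)) :=
  Classical.epsilon_spec h

lemma eval_le_eval_bound {s : Set κ.ord.ToType} (f : s → Tree T Θ κ)
    (h : ∃ y, ∀ x, eval b R (f x) ≤ y) (x : s) : eval b R (f x) ≤ eval b R (bound s f) :=
  Classical.epsilon_spec h x

/-- The preorder on trees induced by their interpretation in a preorder. -/
abbrev preorder (b : T → α) (R : Θ → α → α → Prop) : Preorder (Tree T Θ κ) :=
  Preorder.lift (eval b R)

end

lemma isCardinalFiltered [Fact κ.IsRegular] [IsCardinalFiltered α κ] [Nonempty α] (b : T → α)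
    (R : Θ → α → α → Prop) :
    @IsCardinalFiltered (Tree T Θ κ) (@Preorder.smallCategory _ (preorder b R)) κ _ := by
  let : Preorder (Tree T Θ κ) := preorder b R
  refine isCardinalFiltered_preorder _ κ fun ι f hι => ?_
  obtain ⟨e⟩ : Nonempty (ι ↪ κ.ord.ToType) := by
    rw [← Cardinal.le_def, Cardinal.mk_toType, Cardinal.card_ord]
    exact hι.le
  let e' := Equiv.ofInjective e e.injective
  have hι' : HasCardinalLT ι κ := by rwa [hasCardinalLT_iff_cardinal_mk_lt]
  have h : ∃ y, ∀ x, eval b R (f (e'.symm x)) ≤ y :=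
    ⟨IsCardinalFiltered.max (fun i => eval b R (f i)) hι',
      fun x => leOfHom (IsCardinalFiltered.toMax (fun i => eval b R (f i)) hι' _)⟩
  refine ⟨bound (Set.range e) fun x => f (e'.symm x), fun i => ?_⟩
  have := eval_le_eval_bound b (fun x => f (e'.symm x)) h (e' i)
  rwa [Equiv.symm_apply_apply] at this

end Tree

end Trees

section FilteredDiagrams

/-- A `κ`-filtered diagram in `X` indexed by a preorder on the type `N`. -/
structure FilteredDiagram (N : Type w) (κ : Cardinal.{v}) [Fact κ.IsRegular] (X : Type u')
    [Category.{v} X] where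
  preorder : Preorder N
  isCardinalFiltered : IsCardinalFiltered N κ
  functor : N ⥤ X

namespace FilteredDiagram

variable {N : Type w} {κ : Cardinal.{v}} [Fact κ.IsRegular] {X : Type u'} [Category.{v} X]

/-- The index category of a filtered diagram: the type `N` with the preorder of the diagram. -/
def Shape (_ : FilteredDiagram N κ X) : Type w := N

instance (Δ : FilteredDiagram N κ X) : Preorder Δ.Shape := Δ.preorder

instance (Δ : FilteredDiagram N κ X) : IsCardinalFiltered Δ.Shape κ := Δ.isCardinalFiltered

/-- A filtered diagram as a functor on its index category. -/
def diagram (Δ : FilteredDiagram N κ X) : Δ.Shape ⥤ X := Δ.functor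

end FilteredDiagram

variable {E : Type u} [Category.{v} E] {κ : Cardinal.{v}} [Fact κ.IsRegular]

lemma mono_of_isColimit_comp {ω : Type w} {R : ω → E} [∀ a, IsCardinalPresentable (R a) κ]
    (hR : (ObjectProperty.ofObj R).IsSeparating) {J H : Type v} [SmallCategory J]
    [IsCardinalFiltered J κ] [SmallCategory H] [IsCardinalFiltered H κ] {Ψ : J ⥤ H} {P : H ⥤ E}
    {c : Cocone P} (hc : IsColimit c) {c' : Cocone (Ψ ⋙ P)} (hc' : IsColimit c')
    {m : c'.pt ⟶ c.pt} (hm : ∀ j, c'.ι.app j ≫ m = c.ι.app (Ψ.obj j))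
    (hΨ : ∀ {a j y} {p q : R a ⟶ P.obj (Ψ.obj j)} (f : Ψ.obj j ⟶ y),
      p ≫ P.map f = q ≫ P.map f →
        ∃ (j' : J) (k : j ⟶ j'), p ≫ P.map (Ψ.map k) = q ≫ P.map (Ψ.map k)) : Mono m where
  right_cancellation f g h := by
    have : IsFiltered J := isFiltered_of_isCardinalFiltered J κ
    refine hR _ _ fun G hG t => ?_
    obtain ⟨a⟩ := hG
    obtain ⟨j₁, f₁, hf⟩ := IsCardinalPresentable.exists_hom_of_isColimit κ hc' (t ≫ f)
    obtain ⟨j₂, g₁, hg⟩ := IsCardinalPresentable.exists_hom_of_isColimit κ hc' (t ≫ g)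
    obtain ⟨j, k₁, k₂, -⟩ := IsFilteredOrEmpty.cocone_objs j₁ j₂
    let p : R a ⟶ P.obj (Ψ.obj j) := f₁ ≫ P.map (Ψ.map k₁)
    let q : R a ⟶ P.obj (Ψ.obj j) := g₁ ≫ P.map (Ψ.map k₂)
    have hp : p ≫ c'.ι.app j = t ≫ f := by
      rw [← hf, Category.assoc]
      exact congrArg (f₁ ≫ ·) (c'.w k₁)
    have hq : q ≫ c'.ι.app j = t ≫ g := by
      rw [← hg, Category.assoc]
      exact congrArg (g₁ ≫ ·) (c'.w k₂)
    have hpq : p ≫ c.ι.app (Ψ.obj j) = q ≫ c.ι.app (Ψ.obj j) := by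
      rw [← hm, reassoc_of% hp, reassoc_of% hq, h]
    obtain ⟨y, l, hl⟩ := IsCardinalPresentable.exists_eq_of_isColimit' κ hc p q hpq
    obtain ⟨j', k, hk⟩ := hΨ l hl
    rw [← hp, ← hq, ← c'.w k]
    exact (Category.assoc _ _ _).symm.trans ((congrArg (· ≫ c'.ι.app j') hk).trans
      (Category.assoc _ _ _))

/-- A pair of parallel morphisms from one of the `R a` to a value of one of the `Φ i`. -/
structure ParallelPair {ω ι : Type v} {X : Type v} [SmallCategory X] (R : ω → E)
    (Φ : ι → X ⥤ E) : Type v where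
  a : ω
  i : ι
  x : X
  p : R a ⟶ (Φ i).obj x
  q : R a ⟶ (Φ i).obj x

/-- The relation on the index category of a diagram `F` that holds if some `x ⟶ y` equalizes the
pair `θ`. It is only of interest when the target of `θ` lies over `F.obj x`; the condition is
phrased by quantifying over the components of `θ` to avoid transport along this equality. -/
def ParallelPair.EqualizedAt {ω ι : Type v} {X : Type v} [SmallCategory X] {R : ω → E}
    {Φ : ι → X ⥤ E} {α : Type w} [Category.{w} α] (F : α ⥤ X) (θ : ParallelPair R Φ) (x y : α) :
    Prop :=
  ∃ f : x ⟶ y, ∀ a i p q, θ = ⟨a, i, F.obj x, p, q⟩ →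
    p ≫ (Φ i).map (F.map f) = q ≫ (Φ i).map (F.map f)

variable {ω ι T X : Type v} [SmallCategory X] {R : ω → E} {Φ : ι → X ⥤ E} {α : Type v}
  [Preorder α] [IsCardinalFiltered α κ]

/-- The diagram indexed by trees that is obtained from a diagram `F` on a preorder by interpreting
the leaves as `b` and the operation of a parallel pair as passage to an index equalizing it. -/
def treeDiagram (Φ : ι → X ⥤ E) (R : ω → E) (F : α ⥤ X) (b : T → α) :
    FilteredDiagram (Tree T (ParallelPair R Φ) κ) κ X :=
  haveI := IsCardinalFiltered.nonempty α κ
  letI := Tree.preorder (κ := κ) b (ParallelPair.EqualizedAt (R := R) (Φ := Φ) F)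
  { preorder := inferInstance
    isCardinalFiltered := Tree.isCardinalFiltered b _
    functor := Monotone.functor (f := Tree.eval b _) (fun _ _ h => h) ⋙ F }

/-- The interpretation of trees underlying `treeDiagram`. -/
def treeDiagramEval (Φ : ι → X ⥤ E) (R : ω → E) (F : α ⥤ X) (b : T → α) :
    (treeDiagram (κ := κ) Φ R F b).Shape ⥤ α :=
  haveI := IsCardinalFiltered.nonempty α κ
  letI := Tree.preorder (κ := κ) b (ParallelPair.EqualizedAt (R := R) (Φ := Φ) F)
  Monotone.functor (f := Tree.eval b _) (fun _ _ h => h)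

lemma exists_map_treeDiagramEval_eq {F : α ⥤ X} {b : T → α}
    {x : (treeDiagram (κ := κ) Φ R F b).Shape} {a : ω} {i : ι} {y : α}
    {p q : R a ⟶ (Φ i).obj (F.obj ((treeDiagramEval Φ R F b).obj x))}
    (f : (treeDiagramEval Φ R F b).obj x ⟶ y)
    (h : p ≫ (Φ i).map (F.map f) = q ≫ (Φ i).map (F.map f)) :
    ∃ (x' : (treeDiagram (κ := κ) Φ R F b).Shape) (k : x ⟶ x'),
      p ≫ (Φ i).map (F.map ((treeDiagramEval Φ R F b).map k)) =
        q ≫ (Φ i).map (F.map ((treeDiagramEval Φ R F b).map k)) := by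
  have := IsCardinalFiltered.nonempty α κ
  let θ : ParallelPair R Φ := ⟨a, i, _, p, q⟩
  have hθ : ∃ y, θ.EqualizedAt F ((treeDiagramEval Φ R F b).obj x) y :=
    ⟨y, f, fun _ _ _ _ e => by simp only [θ] at e; cases e; exact h⟩
  obtain ⟨g, hg⟩ := Tree.rel_eval_step b hθ
  have l : @LE.le (treeDiagram (κ := κ) Φ R F b).Shape _ x (.step θ x) := leOfHom g
  exact ⟨_, homOfLE l, hg _ _ _ _ rfl⟩

variable {𝒞 : Type u'} [Category.{w} 𝒞] {K : X ⥤ 𝒞} {Φ : ι → 𝒞 ⥤ E} {F : α ⥤ X}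
  {c : Cocone (F ⋙ K)} {b : T → α}

/-- The cocone on a tree diagram induced by a cocone on the diagram in which trees are
interpreted. -/
def treeCocone (Φ : ι → 𝒞 ⥤ E) (R : ω → E) (c : Cocone (F ⋙ K)) (b : T → α) :
    Cocone ((treeDiagram (κ := κ) (fun i => K ⋙ Φ i) R F b).diagram ⋙ K) :=
  c.whisker (treeDiagramEval (fun i => K ⋙ Φ i) R F b)

lemma mono_map_desc_treeCocone [∀ a, IsCardinalPresentable (R a) κ]
    (hR : (ObjectProperty.ofObj R).IsSeparating)
    (hc : ∀ i, Nonempty (IsColimit ((Φ i).mapCocone c)))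
    {c' : Cocone ((treeDiagram (κ := κ) (fun i => K ⋙ Φ i) R F b).diagram ⋙ K)}
    (hc' : IsColimit c') (hΦc' : ∀ i, Nonempty (IsColimit ((Φ i).mapCocone c'))) (i : ι) :
    Mono ((Φ i).map (hc'.desc (treeCocone Φ R c b))) :=
  mono_of_isColimit_comp (κ := κ) (P := F ⋙ K ⋙ Φ i)
    (Ψ := treeDiagramEval (fun i => K ⋙ Φ i) R F b) hR (hc i).some (hΦc' i).some
    (fun j => ((Φ i).map_comp _ _).symm.trans
      (congrArg (Φ i).map (hc'.fac (treeCocone Φ R c b) j)))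
    (fun f h => exists_map_treeDiagramEval_eq f h)

/-- The comparison morphism `m` is monic for the functors `Φ i` since the tree diagram is closed
under passage to an index equalizing a given pair. The diagrams that can occur form a small set
independent of the object `c.pt`. -/
lemma exists_filteredDiagram [∀ a, IsCardinalPresentable (R a) κ]
    (hR : (ObjectProperty.ofObj R).IsSeparating)
    (hc : ∀ i, Nonempty (IsColimit ((Φ i).mapCocone c))) (a : T → ω) (i : T → ι)
    (p : ∀ t, R (a t) ⟶ (Φ (i t)).obj c.pt) :
    ∃ Δ : FilteredDiagram (Tree T (ParallelPair R fun i => K ⋙ Φ i) κ) κ X,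
      ∀ c' : Cocone (Δ.diagram ⋙ K), Nonempty (IsColimit c') →
        (∀ i, Nonempty (IsColimit ((Φ i).mapCocone c'))) →
          ∃ m : c'.pt ⟶ c.pt, (∀ i, Mono ((Φ i).map m)) ∧
            ∀ t, ∃ z : R (a t) ⟶ (Φ (i t)).obj c'.pt, z ≫ (Φ (i t)).map m = p t := by
  choose b z hz using fun t =>
    IsCardinalPresentable.exists_hom_of_isColimit κ (hc (i t)).some (p t)
  refine ⟨treeDiagram _ R F b, fun c' ⟨hc'⟩ hΦc' => ⟨hc'.desc (treeCocone Φ R c b),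
    mono_map_desc_treeCocone hR hc hc' hΦc', fun t => ?_⟩⟩
  let x : (treeDiagram (κ := κ) (fun i => K ⋙ Φ i) R F b).Shape := Tree.base t
  have hx : (Φ (i t)).map (c'.ι.app x) ≫ (Φ (i t)).map (hc'.desc (treeCocone Φ R c b)) =
      (Φ (i t)).map (c.ι.app (b t)) := by
    rw [← Functor.map_comp, hc'.fac]
    rfl
  exact ⟨z t ≫ (Φ (i t)).map (c'.ι.app x), (Category.assoc _ _ _).trans
    ((congrArg (z t ≫ ·) hx).trans (hz t))⟩

end FilteredDiagrams

section ConicalColimits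

variable {C : Type u'} [EnrichedCategory V C]

section

variable {H : Type v} [SmallCategory H] {F : H ⥤ ForgetEnrichment V C}
  {c : Cocone F}

namespace IsConicalColimit

lemma whisker (hc : IsConicalColimit c) {J : Type v} [SmallCategory J] (Ψ : J ⥤ H) [Ψ.Final] :
    IsConicalColimit (c.whisker Ψ) :=
  ⟨hc.1.map fun h => (Functor.Final.isColimitWhiskerEquiv Ψ c).symm h,
    fun X => (hc.2 X).map fun h => (Functor.Initial.isLimitWhiskerEquiv Ψ.op
      (((eHomFunctor V (ForgetEnrichment V C)).flip.obj X).mapCone c.op)).symm h⟩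

lemma precompose (hc : IsConicalColimit c) {F' : H ⥤ ForgetEnrichment V C} (e : F' ≅ F) :
    IsConicalColimit ((Cocone.precompose e.hom).obj c) := by
  refine ⟨hc.1.map fun h => (IsColimit.precomposeHomEquiv e c).symm h, fun X => ?_⟩
  let Φ := (eHomFunctor V (ForgetEnrichment V C)).flip.obj X
  refine (hc.2 X).map fun h => ?_
  refine IsLimit.ofIsoLimit ((IsLimit.postcomposeHomEquiv
    (Functor.isoWhiskerRight (NatIso.op e) Φ) (Φ.mapCone c.op)).symm h) ?_
  exact Cone.ext (Iso.refl _) fun j => by simp [Φ]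

lemma hom_ext (hc : IsConicalColimit c) {X : ForgetEnrichment V C} {Y : V}
    {f g : Y ⟶ (c.pt ⟶[V] X)}
    (h : ∀ j, f ≫ eHomWhiskerRight V (c.ι.app j) X = g ≫ eHomWhiskerRight V (c.ι.app j) X) :
    f = g :=
  (hc.2 X).some.hom_ext fun j => h j.unop

lemma exists_lift (hc : IsConicalColimit c) {X : ForgetEnrichment V C} {Y : V}
    (z : ∀ j, Y ⟶ (F.obj j ⟶[V] X))
    (hz : ∀ {i j} (f : i ⟶ j), z j ≫ eHomWhiskerRight V (F.map f) X = z i) :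
    ∃ l : Y ⟶ (c.pt ⟶[V] X), ∀ j, l ≫ eHomWhiskerRight V (c.ι.app j) X = z j :=
  let s : Cone (F.op ⋙ (eHomFunctor V (ForgetEnrichment V C)).flip.obj X) :=
    { pt := Y
      π := { app j := z j.unop
             naturality _ _ f := (Category.id_comp _).trans (hz f.unop).symm } }
  ⟨(hc.2 X).some.lift s, fun j => (hc.2 X).some.fac s (op j)⟩

variable {A B : ForgetEnrichment V C} {m : B ⟶ A}

lemma mono_eHomWhiskerLeft (hc : IsConicalColimit c)
    (hm : ∀ j, Mono (eHomWhiskerLeft V (F.obj j) m)) : Mono (eHomWhiskerLeft V c.pt m) where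
  right_cancellation f g h := hc.hom_ext fun j => by
    have := hm j
    have exchange := eHom_whisker_exchange V (c.ι.app j) m
    have h' := congrArg (· ≫ eHomWhiskerRight V (c.ι.app j) A) h
    simp only [Category.assoc] at h'
    rw [← cancel_mono (eHomWhiskerLeft V (F.obj j) m), Category.assoc, Category.assoc]
    exact (congrArg (f ≫ ·) exchange).symm.trans (h'.trans (congrArg (g ≫ ·) exchange))

lemma exists_factor (hc : IsConicalColimit c) (hm : ∀ j, Mono (eHomWhiskerLeft V (F.obj j) m))
    {Y : V} (x : Y ⟶ (c.pt ⟶[V] A))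
    (hx : ∀ j, ∃ z : Y ⟶ (F.obj j ⟶[V] B),
      z ≫ eHomWhiskerLeft V (F.obj j) m = x ≫ eHomWhiskerRight V (c.ι.app j) A) :
    ∃ z : Y ⟶ (c.pt ⟶[V] B), z ≫ eHomWhiskerLeft V c.pt m = x := by
  choose z hz using hx
  obtain ⟨l, hl⟩ := hc.exists_lift z fun {i j} f => by
    have := hm i
    rw [← cancel_mono (eHomWhiskerLeft V (F.obj i) m), hz, Category.assoc,
      ← eHom_whisker_exchange, reassoc_of% (hz j), ← eHomWhiskerRight_comp, c.w]
  refine ⟨l, hc.hom_ext fun j => ?_⟩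
  rw [← hz j, ← hl j, Category.assoc, Category.assoc]
  exact congrArg _ (eHom_whisker_exchange V (c.ι.app j) m)

end IsConicalColimit

end

lemma exists_directed_presentation {κ : Cardinal.{v}} [Fact κ.IsRegular]
    {ι : Type v} {G : ι → ForgetEnrichment V C} {X : ForgetEnrichment V C}
    (hX : ∃ (H : Type v) (_ : SmallCategory H) (_ : IsCardinalFiltered H κ)
        (F : H ⥤ ForgetEnrichment V C) (t : F ⟶ (Functor.const H).obj X),
        (∀ h, ∃ i, Nonempty (F.obj h ≅ G i)) ∧ IsConicalColimit ⟨X, t⟩) :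
    ∃ (α : Type v) (_ : Preorder α) (_ : IsCardinalFiltered α κ)
      (F : α ⥤ InducedCategory (ForgetEnrichment V C) G)
      (t : F ⋙ inducedFunctor G ⟶ (Functor.const α).obj X), IsConicalColimit ⟨X, t⟩ := by
  obtain ⟨H, _, _, F, t, hF, ht⟩ := hX
  obtain ⟨α, _, hα, Ψ, _⟩ := IsCardinalFiltered.exists_cardinal_directed H κ
  choose i e using hF
  let e' h := (e h).some
  let F' : α ⥤ InducedCategory (ForgetEnrichment V C) G :=
    { obj a := i (Ψ.obj a)
      map f := InducedCategory.homMk ((e' _).inv ≫ F.map (Ψ.map f) ≫ (e' _).hom)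
      map_id a := by ext; simp
      map_comp f g := by ext; simp }
  let iso : F' ⋙ inducedFunctor G ≅ Ψ ⋙ F :=
    NatIso.ofComponents (fun a => (e' (Ψ.obj a)).symm) fun f => by simp [F']
  exact ⟨α, inferInstance, hα, F', _, (ht.whisker Ψ).precompose iso⟩

end ConicalColimits

section SolutionSet

variable {C : Type u'} [EnrichedCategory V C]

lemma hcomp_postComp {A B D E : C} (u : 𝟙_ V ⟶ EnrichedCategory.Hom D E) {X Y : V}
    (f : X ⟶ EnrichedCategory.Hom A B) (g : Y ⟶ EnrichedCategory.Hom B D) :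
    hcomp f (g ≫ postComp u B) = hcomp f g ≫ postComp u A := by
  rw [comp_postComp, comp_postComp, hcomp_comp_right, hcomp_assoc]
  simp

lemma postComp_homTo {A B : C} (m : ForgetEnrichment.of V B ⟶ ForgetEnrichment.of V A) (X : C) :
    postComp (ForgetEnrichment.homTo V m) X =
      eHomWhiskerLeft V (ForgetEnrichment.of V X) m := by
  rw [postComp, hcomp, MonoidalCategory.id_tensorHom]
  rfl

variable [SymmetricCategory V] [MonoidalClosed V] [HasLimits V] {D : Type v}
  [EnrichedCategory V D] {W : EnrichedFunctor V Dᵒᵖ V} {S : EnrichedFunctor V D C}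

lemma exists_evalAt_eq {A B : C} (u : 𝟙_ V ⟶ EnrichedCategory.Hom B A)
    (hu : ∀ d : Dᵒᵖ, Mono (postComp u (S.obj d.unop))) (y : 𝟙_ V ⟶ (natFunctor W S).obj A)
    (hy : ∀ d : Dᵒᵖ, ∃ z : W.obj d ⊗ 𝟙_ V ⟶ EnrichedCategory.Hom (S.obj d.unop) B,
      z ≫ postComp u (S.obj d.unop) = leftFamily y d) :
    ∃ x : 𝟙_ V ⟶ (natFunctor W S).obj B, evalAt (natFunctor W S) x u = y := by
  choose z hz using hy
  have hnat : IsLeftNatFamily W S z := fun X Y => by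
    have := hu Y
    rw [← cancel_mono (postComp u (S.obj Y.unop)), ← hcomp_postComp, hz, Category.assoc,
      Category.assoc, hz]
    exact isLeftNatFamily_leftFamily y X Y
  refine ⟨leftLift z hnat, leftFamily_ext fun X => ?_⟩
  have e : (ρ_ (W.obj X)).inv ▷ 𝟙_ V = (ρ_ (W.obj X ⊗ 𝟙_ V)).inv := by monoidal
  rw [leftFamily_evalAt, leftFamily_leftLift, hcomp_comp_left, e, ← comp_postComp, hz]

lemma exists_evalAt_eq_of_isStrongGenerator {P : ObjectProperty V} (hP : P.IsStrongGenerator)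
    {H : Dᵒᵖ → Type v} [∀ d, SmallCategory (H d)] {F : ∀ d, H d ⥤ ForgetEnrichment V C}
    {t : ∀ d, F d ⟶ (Functor.const _).obj (ForgetEnrichment.of V (S.obj d.unop))}
    (ht : ∀ d, IsConicalColimit ⟨_, t d⟩) {A B : C}
    (m : ForgetEnrichment.of V B ⟶ ForgetEnrichment.of V A)
    (hm : ∀ d j, Mono (eHomWhiskerLeft V ((F d).obj j) m)) (y : 𝟙_ V ⟶ (natFunctor W S).obj A)
    (hy : ∀ d j R, P R → ∀ q : R ⟶ W.obj d ⊗ 𝟙_ V,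
      ∃ z : R ⟶ ((F d).obj j ⟶[V] ForgetEnrichment.of V B),
        z ≫ eHomWhiskerLeft V ((F d).obj j) m =
          q ≫ leftFamily y d ≫ eHomWhiskerRight V ((t d).app j) (ForgetEnrichment.of V A)) :
    ∃ x : 𝟙_ V ⟶ (natFunctor W S).obj B,
      evalAt (natFunctor W S) x (ForgetEnrichment.homTo V m) = y := by
  refine exists_evalAt_eq _ (fun d => ?_) y fun d => ?_
  · rw [postComp_homTo]
    exact (ht d).mono_eHomWhiskerLeft (hm d)
  · rw [postComp_homTo]
    refine (ht d).exists_factor (hm d) (leftFamily y d) fun j => ?_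
    have := hm d j
    exact exists_factor_of_isStrongGenerator hP _ _ (hy d j)

lemma hasSolutionSet_natFunctor {κ₀ κ : Cardinal.{v}} [Fact κ₀.IsRegular] [Fact κ.IsRegular]
    (hκ : κ₀ ≤ κ) [HasCardinalFilteredGenerator V κ₀] (hC : IsEnrichedCardinalAccessible V C κ)
    (W : EnrichedFunctor V Dᵒᵖ V) (S : EnrichedFunctor V D C) :
    HasSolutionSet (natFunctor W S) := by
  obtain ⟨ω, R, _, hR⟩ := exists_isStrongGenerator_ofObj V hκ
  obtain ⟨ι, G, hG, hpres⟩ := hC.exists_generator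
  have hdir (X : ForgetEnrichment V C) := exists_directed_presentation (hpres X)
  choose α _ _ F t ht using fun d : Dᵒᵖ => hdir (ForgetEnrichment.of V (S.obj d.unop))
  let T := Σ d : Dᵒᵖ, α d × Σ a, R a ⟶ W.obj d ⊗ 𝟙_ V
  let Diagrams := FilteredDiagram
    (Tree T (ParallelPair R fun i => inducedFunctor G ⋙ eCoyoneda V (G i)) κ) κ
    (InducedCategory (ForgetEnrichment V C) G)
  choose c hc using fun Δ : Diagrams => hC.exists_colimit Δ.Shape (Δ.diagram ⋙ inducedFunctor G)
  refine ⟨Σ Δ : Diagrams, 𝟙_ V ⟶ (natFunctor W S).obj (c Δ).pt, fun i => ⟨(c i.1).pt, i.2⟩,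
    fun y => ?_⟩
  obtain ⟨β, _, _, _, t', ht'⟩ := hdir (ForgetEnrichment.of V y.obj)
  obtain ⟨Δ, hΔ⟩ := exists_filteredDiagram (κ := κ) (R := R) (Φ := fun i => eCoyoneda V (G i))
    hR.isSeparating (fun i => hG i _ _ _ ht') (T := T) (fun s => s.2.2.1)
    (fun s => (F s.1).obj s.2.1)
    fun s => s.2.2.2 ≫ leftFamily y.point s.1 ≫ eHomWhiskerRight V ((t s.1).app s.2.1) _
  obtain ⟨m, hm, hz⟩ := hΔ (c Δ) (hc Δ).1 fun i => hG i _ _ _ (hc Δ)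
  obtain ⟨x, hx⟩ := exists_evalAt_eq_of_isStrongGenerator hR ht m (fun d j => hm ((F d).obj j))
    y.point (by rintro d j _ ⟨a⟩ q; exact hz ⟨d, j, a, q⟩)
  exact ⟨⟨Δ, x⟩, ForgetEnrichment.homTo V m, hx⟩

end SolutionSet

end
end EWeak

theorem mainTheorem2_general (V : Type u) [Category.{v} V] [MonoidalCategory V]
    [SymmetricCategory V] [MonoidalClosed V] [HasLimits V] [ModelCategory V]
    (hI : IsCofibrant (𝟙_ V)) (C : Type u') [EnrichedCategory V C] {κ₀ κ : Cardinal.{v}}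
    [Fact κ₀.IsRegular] [Fact κ.IsRegular] (hκ : κ₀ ≤ κ) [HasCardinalFilteredGenerator V κ₀]
    (hC : EWeak.IsEnrichedCardinalAccessible V C κ) (hpow : EWeak.HasPowers V C)
    (hlim : EWeak.HasEnoughCofibrantlyWeightedLimits V C) :
    EWeak.HasShrinkableWeakColimits V C :=
  EWeak.hasShrinkableWeakColimits_of_hasSolutionSet hI hpow hlim
    fun W S => EWeak.hasSolutionSet_natFunctor hκ hC W S

theorem mainTheorem2 (V : Type u) [Category.{v} V] [MonoidalCategory V] [SymmetricCategory V]
    [MonoidalClosed V] [HasLimits V] [HasColimits V] [IsLocallyPresentable.{v} V]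
    [ModelCategory V] (hV : EWeak.IsMonoidalModel V)
    (C : Type u') [EnrichedCategory V C] (hacc : EWeak.IsEnrichedAccessible V C)
    (hpow : EWeak.HasPowers V C) (hlim : EWeak.HasEnoughCofibrantlyWeightedLimits V C) :
    EWeak.HasShrinkableWeakColimits V C := by
  obtain ⟨_, _, _, _, ⟨_, _, _⟩, hκ, hC⟩ := hacc
  exact mainTheorem2_general V hV.isCofibrant_unit C hκ hC hpow hlim
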